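/- Let $N,m\ge 0$ be integers, let $0<\lambda_1<\lambda_2<\dots$ be real numbers and let $P_\alpha$ ($\alpha\ge1$) be orthogonal projectors in $\mathbb C^N$, $k_\alpha=\operatorname{rank}P_\alpha$. Let $e_1,\dots,e_N$ be the standard basis of $\mathbb C^N$. Let $A\subset\{1,2,\dots\}$ be a finite set such that for every $\alpha\notin A$ the projector $P_\alpha$ is a coordinate projector, i.e. the orthogonal projector onto the span of some of the vectors $e_j$ (multiple eigenvalues are admitted). For $j=1,\dots,N$ put $$A_j^0=\{\alpha\notin A:\ P_\alpha e_j\neq0\}.$$ Assume that there is $C>0$ such that * every $\lambda_\alpha$ satisfies $|\lambda_\alpha-\pi^2n^2|\le C$ for some integer $n\ge0$; * for all sufficiently large $n$ and all $j=1,\dots,N$ the set $\{\lambda_\alpha:\alpha\in A_j^0\}\cap(-\infty,\pi^2n^2+C]$ consists of exactly $n-m$ points. Assume also that $\sum_{\alpha\in A}k_\alpha=Nm$. Define $$f_j(\lambda)=\prod_{\alpha\in A_j^0}\Bigl(1-\frac{\lambda}{\lambda_\alpha}\Bigr),\qquad F(\lambda)=\operatorname{diag}\{f_1(\lambda),\dots,f_N(\lambda)\},\qquad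 T_k=\sum_{\alpha\in A}\lambda_\alpha^kF(\lambda_\alpha)P_\alpha F(\lambda_\alpha)\quad(k\ge0),$$ and let $\mathcal T=(T_{p+q})_{p,q=0}^{m-1}$ be the $Nm\times Nm$ block Hankel matrix. Then the products $f_j$ converge on $\mathbb C$, $T_k=T_k^*$ for all $k$, $\mathcal T=\mathcal T^*\ge0$, and the following are equivalent: 1. (condition (C)) if $\xi:\mathbb C\to\mathbb C^N$ is an entire function with $P_\alpha\xi(\lambda_\alpha)=0$ for all $\alpha\ge1$, $\xi(\lambda)=O(e^{|\operatorname{Im}\sqrt\lambda|})$ as $|\lambda|\to\infty$ and $\xi\in L^2(\mathbb R_+)$, then $\xi\equiv0$; 2. $\mathcal T>0$ (positive definite); 3. $\det\mathcal T\neq0$. -/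

import Mathlib

open scoped Matrix ComplexOrder

noncomputable section

namespace VectorSL

/-- The growth and integrability class appearing in condition (C): entire functions
`ξ : ℂ → ℂ^N` with `ξ(z) = O(exp |Im √z|)` as `|z| → ∞` and `ξ ∈ L²(ℝ₊)`.
(`|Im √z|` does not depend on the branch of the square root.) -/
structure IsAdmissible {N : ℕ} (ξ : ℂ → EuclideanSpace ℂ (Fin N)) : Prop where
  entire : Differentiable ℂ ξ
  growth : ξ =O[Bornology.cobounded ℂ] fun z : ℂ => Real.exp |(z ^ (1 / 2 : ℂ)).im|
  memLp : MeasureTheory.MemLp (fun t : ℝ => ξ (t : ℂ)) 2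
    (MeasureTheory.volume.restrict (Set.Ioi (0 : ℝ)))

/-- Condition (C) for the collection `(lam α ; P α)`: an admissible `ξ` with
`P α ξ(lam α) = 0` for all `α` vanishes identically. -/
def ConditionC {N : ℕ} (lam : ℕ → ℝ) (P : ℕ → Matrix (Fin N) (Fin N) ℂ) : Prop :=
  ∀ ξ : ℂ → EuclideanSpace ℂ (Fin N), IsAdmissible ξ →
    (∀ α, P α *ᵥ (ξ (lam α : ℂ)).ofLp = 0) → ∀ z, ξ z = 0

/-- `Q` is the orthogonal projector of `ℂ^N` onto the span of some of the standard
basis vectors. -/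
def IsCoordinateProjector {N : ℕ} (Q : Matrix (Fin N) (Fin N) ℂ) : Prop :=
  ∃ S : Finset (Fin N), Q = Matrix.diagonal fun j => if j ∈ S then (1 : ℂ) else 0

/-- `A_j^0 = {α ∉ A : P α e_j ≠ 0}`. -/
def unperturbedIndices {N : ℕ} (P : ℕ → Matrix (Fin N) (Fin N) ℂ) (A : Finset ℕ)
    (j : Fin N) : Set ℕ :=
  {α | α ∉ A ∧ P α *ᵥ (Pi.single j 1 : Fin N → ℂ) ≠ 0}

/-- `f_j(z) = ∏_{α ∈ A_j^0} (1 - z / lam α)`. -/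
def canonicalProduct {N : ℕ} (lam : ℕ → ℝ) (P : ℕ → Matrix (Fin N) (Fin N) ℂ)
    (A : Finset ℕ) (j : Fin N) (z : ℂ) : ℂ :=
  ∏' α : unperturbedIndices P A j, (1 - z / (lam α : ℂ))

/-- `F(z) = diag (f_1(z), …, f_N(z))`. -/
def diagF {N : ℕ} (lam : ℕ → ℝ) (P : ℕ → Matrix (Fin N) (Fin N) ℂ)
    (A : Finset ℕ) (z : ℂ) : Matrix (Fin N) (Fin N) ℂ :=
  Matrix.diagonal fun j => canonicalProduct lam P A j z

/-- `T_k = ∑_{α ∈ A} (lam α)^k F(lam α) P_α F(lam α)`. -/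
def hankelCoeff {N : ℕ} (lam : ℕ → ℝ) (P : ℕ → Matrix (Fin N) (Fin N) ℂ)
    (A : Finset ℕ) (k : ℕ) : Matrix (Fin N) (Fin N) ℂ :=
  ∑ α ∈ A, ((lam α : ℂ) ^ k) •
    (diagF lam P A (lam α : ℂ) * P α * diagF lam P A (lam α : ℂ))

/-- The `Nm × Nm` block Hankel matrix with blocks `T_{p+q}`, `0 ≤ p, q ≤ m - 1`. -/
def blockHankel {N : ℕ} (lam : ℕ → ℝ) (P : ℕ → Matrix (Fin N) (Fin N) ℂ)
    (A : Finset ℕ) (m : ℕ) : Matrix (Fin m × Fin N) (Fin m × Fin N) ℂ :=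
  Matrix.of fun p q => hankelCoeff lam P A ((p.1 : ℕ) + (q.1 : ℕ)) p.2 q.2

end VectorSL

end

/-! For `α ∉ A` the projectors are coordinate projectors, so these interpolation conditions
decouple: they say that each component `ξ_j` vanishes at the zeros of `f_j`. Those zeros, listed in
increasing order, lie at bounded distance from `π²(k+m+1)²` (`exists_equiv_isPerturbedDirichlet`).
Comparison with Euler's product, whose first `m` factors are missing here, shows that `|f_j(w²)|` is
of the order of `|sin w| / |w|^(2m+1)` for large `w` away from `πℤ` (`exists_bounds_away`).

Hence `ξ_j / f_j` is entire and `O(|z|^(m+1/2))` on the circles `|√z| = (n+1/2)π`, so it is a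
polynomial of degree at most `m` (`exists_polynomial_factor`). Degree exactly `m` would make
`|ξ_j(t)|²` at least a multiple of `1/t` on intervals where this has infinite integral
(`leadingCoeff_eq_zero_of_memLp`). Conversely `f_j p` with `deg p < m` is admissible
(`isAdmissible_canonicalProduct_mul`). The candidates are thus exactly `ξ = F p`, with `p` a vector
of `Nm` coefficients.

What remains is `P_α F(λ_α) p(λ_α) = 0` for `α ∈ A`. The squared norms of these vectors add up to
the quadratic form of the block Hankel matrix at `p` (`blockHankel_eq_sum`), so condition (C) says
that this nonnegative form has no nonzero null vector. That is positive definiteness, and for a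
positive semidefinite matrix it is the same as a nonzero determinant. -/

noncomputable section

namespace VectorSL

open Filter Topology MeasureTheory

/-! ### Infinite products of linear factors and their zeros -/

/-- The entire function `z ↦ ∏ (1 - z c_i)` attached to a summable sequence `c`. -/
def linearProduct (c : ℕ → ℂ) (z : ℂ) : ℂ := ∏' i, (1 - z * c i)

section LinearProduct

variable {c : ℕ → ℂ}

lemma summable_norm_neg_mul (hc : Summable fun i => ‖c i‖) (z : ℂ) :
    Summable fun i => ‖-(z * c i)‖ := by
  simpa [norm_mul] using hc.mul_left ‖z‖

lemma multipliable_one_sub_mul (hc : Summable fun i => ‖c i‖) (z : ℂ) :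
    Multipliable fun i => 1 - z * c i := by
  simpa [sub_eq_add_neg] using multipliable_one_add_of_summable (summable_norm_neg_mul hc z)

lemma tendsto_prod_range_linearProduct (hc : Summable fun i => ‖c i‖) (z : ℂ) :
    Tendsto (fun n => ∏ i ∈ Finset.range n, (1 - z * c i)) atTop (𝓝 (linearProduct c z)) :=
  (multipliable_one_sub_mul hc z).hasProd.tendsto_prod_nat

lemma differentiable_linearProduct (hc : Summable fun i => ‖c i‖) :
    Differentiable ℂ (linearProduct c) := by
  intro a
  -- On this ball the summable sequence `(‖a‖ + 1) * ‖c n‖` dominates the terms, so the partial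
  -- products converge locally uniformly.
  have hU : IsOpen (Metric.ball (0 : ℂ) (‖a‖ + 1)) := Metric.isOpen_ball
  have h := (hc.mul_left (‖a‖ + 1)).hasProdLocallyUniformlyOn_nat_one_add
    (f := fun i z => -(z * c i)) hU (Eventually.of_forall fun n x hx => by
      rw [norm_neg, norm_mul]
      have : ‖x‖ < ‖a‖ + 1 := by simpa using hx
      gcongr) (fun n => by fun_prop)
  have hd := h.differentiableOn (Eventually.of_forall fun s => by
    simpa [Finset.prod_fn] using DifferentiableOn.finsetProd (fun _ _ ↦ by fun_prop)) hU
  have := hd.differentiableAt (hU.mem_nhds (show a ∈ Metric.ball (0 : ℂ) (‖a‖ + 1) by simp))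
  simpa only [linearProduct, sub_eq_add_neg] using! this

lemma linearProduct_ne_zero (hc : Summable fun i => ‖c i‖) {z : ℂ} (hz : ∀ i, z * c i ≠ 1) :
    linearProduct c z ≠ 0 := by
  have := tprod_one_add_ne_zero_of_summable (f := fun i => -(z * c i))
    (fun i h => hz i (by linear_combination -h)) (summable_norm_neg_mul hc z)
  simpa only [linearProduct, sub_eq_add_neg] using this

lemma summable_norm_update (hc : Summable fun i => ‖c i‖) (k : ℕ) :
    Summable fun i => ‖Function.update c k 0 i‖ := by
  refine hc.of_nonneg_of_le (fun _ => norm_nonneg _) fun i => ?_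
  by_cases h : i = k
  · subst h; simp
  · simp [h]

/-- Replacing `c k` by `0` turns the `k`-th factor into `1`; this is how a single zero is split off.
-/
lemma linearProduct_eq_mul_update (hc : Summable fun i => ‖c i‖) (k : ℕ) (z : ℂ) :
    linearProduct c z = (1 - z * c k) * linearProduct (Function.update c k 0) z := by
  have hu : Function.update (fun i => 1 - z * c i) k 1
      = fun i => 1 - z * Function.update c k 0 i := by
    funext i
    by_cases h : i = k
    · subst h; simp
    · simp [h]
  have hm : Multipliable (Function.update (fun i => 1 - z * c i) k 1) := by
    rw [hu]
    exact multipliable_one_sub_mul (summable_norm_update hc k) z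
  rw [linearProduct, hm.tprod_eq_mul_tprod_ite' k, linearProduct, ← hu]
  congr 1
  refine tprod_congr fun i => ?_
  by_cases h : i = k
  · subst h; simp
  · simp [h]

lemma linearProduct_eq_zero (hc : Summable fun i => ‖c i‖) {k : ℕ} {z : ℂ} (hz : z * c k = 1) :
    linearProduct c z = 0 := by
  rw [linearProduct_eq_mul_update hc k, hz]
  simp

lemma deriv_linearProduct_ne_zero (hc : Summable fun i => ‖c i‖) (hinj : Function.Injective c)
    {z : ℂ} (hz : linearProduct c z = 0) : deriv (linearProduct c) z ≠ 0 := by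
  obtain ⟨k, hk⟩ : ∃ k, z * c k = 1 := by
    by_contra! h
    exact linearProduct_ne_zero hc h hz
  have hz0 : z ≠ 0 := by rintro rfl; simp at hk
  have hck : c k ≠ 0 := by intro h; simp [h] at hk
  set h := linearProduct (Function.update c k 0) with hh
  have hd : Differentiable ℂ h := differentiable_linearProduct (summable_norm_update hc k)
  have hf : linearProduct c = fun z => (1 - z * c k) * h z :=
    funext fun z => linearProduct_eq_mul_update hc k z
  have hne : h z ≠ 0 := by
    refine linearProduct_ne_zero (summable_norm_update hc k) fun i hi => ?_
    by_cases hik : i = k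
    · subst hik; simp at hi
    · rw [Function.update_of_ne hik] at hi
      exact hik (hinj (mul_left_cancel₀ hz0 (hi.trans hk.symm)))
  have h1 : HasDerivAt (fun z => 1 - z * c k) (-(c k)) z := by
    simpa using ((hasDerivAt_id z).mul_const (c k)).const_sub 1
  rw [hf, (h1.fun_mul (hd z).hasDerivAt).deriv, hk]
  simpa using ⟨hck, hne⟩

end LinearProduct

/-! ### Division of entire functions and a Liouville theorem on circles -/

/-- An entire function vanishing at the zeros of an entire function with simple zeros is
divisible by it. -/
lemma exists_entire_quotient {f ξ : ℂ → ℂ} (hf : Differentiable ℂ f) (hξ : Differentiable ℂ ξ)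
    (hsimple : ∀ a, f a = 0 → deriv f a ≠ 0) (hzero : ∀ a, f a = 0 → ξ a = 0) :
    ∃ g : ℂ → ℂ, Differentiable ℂ g ∧ ∀ z, ξ z = f z * g z := by
  classical
  -- At a zero the value is the limit of the quotient. Near a zero `a` the function equals `dslope ξ
  -- a / dslope f a`, whose denominator does not vanish because the zero is simple.
  refine ⟨fun z => if f z = 0 then deriv ξ z / deriv f z else ξ z / f z, fun a => ?_, fun z => ?_⟩
  · by_cases ha : f a = 0
    · have hds : ∀ {φ : ℂ → ℂ}, Differentiable ℂ φ → DifferentiableAt ℂ (dslope φ a) a :=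
        fun h => ((Complex.differentiableOn_dslope univ_mem).2
          h.differentiableOn).differentiableAt univ_mem
      have hsl : ∀ {φ : ℂ → ℂ}, φ a = 0 → ∀ z, φ z = (z - a) * dslope φ a z := by
        intro φ h0 z
        simpa [h0] using (sub_smul_dslope φ a z).symm
      have hne : dslope f a a ≠ 0 := by simpa using hsimple a ha
      have hev : ∀ᶠ z in 𝓝 a, dslope f a z ≠ 0 := (hds hf).continuousAt.eventually_ne hne
      refine ((hds hξ).fun_div (hds hf) hne).congr_of_eventuallyEq ?_
      filter_upwards [hev] with z hz
      by_cases hza : z = a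
      · subst hza; simp [ha]
      · have hz' : z - a ≠ 0 := sub_ne_zero.2 hza
        have hfz : f z ≠ 0 := by
          rw [hsl ha z]; exact mul_ne_zero hz' hz
        rw [if_neg hfz, hsl ha z, hsl (hzero a ha) z, mul_div_mul_left _ _ hz']
    · have hev : ∀ᶠ z in 𝓝 a, f z ≠ 0 := (hf a).continuousAt.eventually_ne ha
      refine ((hξ a).fun_div (hf a) ha).congr_of_eventuallyEq ?_
      filter_upwards [hev] with z hz
      rw [if_neg hz]
  · by_cases hz : f z = 0
    · simp [hz, hzero z hz]
    · simp only [if_neg hz]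
      field_simp

/-- An entire function whose growth along a sequence of circles is `o(R ^ (m + 1))` is a
polynomial of degree at most `m`. -/
lemma exists_polynomial_of_growth {g : ℂ → ℂ} (hg : Differentiable ℂ g) (m : ℕ) {R M : ℕ → ℝ}
    (hR : Tendsto R atTop atTop)
    (hM : Tendsto (fun n => M n / R n ^ (m + 1)) atTop (𝓝 0))
    (hb : ∀ᶠ n in atTop, ∀ z : ℂ, ‖z‖ = R n → ‖g z‖ ≤ M n) :
    ∃ a : ℕ → ℂ, ∀ z, g z = ∑ k ∈ Finset.range (m + 1), a k * z ^ k := by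
  -- Cauchy's estimate gives `k! * M n / R n ^ k`, and `R n ≥ 1` allows the exponent to be lowered
  -- to `m + 1`.
  have hd : ∀ k, m + 1 ≤ k → iteratedDeriv k g 0 = 0 := by
    intro k hk
    rw [← norm_le_zero_iff]
    have hlim : Tendsto (fun n => (k.factorial : ℝ) * (M n / R n ^ (m + 1))) atTop (𝓝 0) := by
      simpa using hM.const_mul (k.factorial : ℝ)
    refine ge_of_tendsto hlim ?_
    filter_upwards [hb, hR.eventually_ge_atTop 1] with n hn h1
    have h0 : 0 < R n := by linarith
    have hM0 : 0 ≤ M n := (norm_nonneg _).trans (hn (R n : ℂ) (by simp [abs_of_pos h0]))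
    refine (Complex.norm_iteratedDeriv_le_of_forall_mem_sphere_norm_le k h0 hg.diffContOnCl
      (fun z hz => hn z (by simpa using hz))).trans ?_
    rw [mul_div_assoc]
    gcongr
  refine ⟨fun k => (k.factorial : ℂ)⁻¹ * iteratedDeriv k g 0, fun z => ?_⟩
  rw [← Complex.taylorSeries_eq_of_entire' 0 z hg, tsum_eq_sum (s := Finset.range (m + 1))]
  · simp
  · intro k hk
    simp [hd k (by simpa using hk)]

/-! ### Products with nearby zeros -/

/-- The entire function `z ↦ ∏ (1 - z / ν_k)` with zeros at the points `ν_k`. -/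
def zeroProduct (ν : ℕ → ℝ) : ℂ → ℂ := linearProduct fun k => ((ν k : ℂ))⁻¹

lemma summable_norm_inv_ofReal {ν : ℕ → ℝ} (hs : Summable fun k => (ν k)⁻¹) :
    Summable fun k => ‖((ν k : ℂ))⁻¹‖ := by
  simpa [abs_inv] using hs.abs

/-- Write `|1 - z/ν| = |ν - z| / ν`. Moving `ν` to `κ` costs a factor `1 + C/ν` in the denominator
and `1 + C/|κ - z|` in the numerator; putting both into exponentials lets the errors add up over the
product. -/
lemma norm_one_sub_mul_inv_le {ν κ C : ℝ} (hν : 0 < ν) (hκ : 0 < κ) (hC : |ν - κ| ≤ C) {z : ℂ}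
    (hz : (κ : ℂ) ≠ z) :
    ‖1 - z * (ν : ℂ)⁻¹‖ ≤ Real.exp (C * ν⁻¹ + C * ‖(κ : ℂ) - z‖⁻¹) * ‖1 - z * (κ : ℂ)⁻¹‖ := by
  have hd : 0 < ‖(κ : ℂ) - z‖ := norm_pos_iff.2 (sub_ne_zero.2 hz)
  have hC0 : 0 ≤ C := (abs_nonneg _).trans hC
  have key : ∀ a : ℝ, 0 < a → ‖1 - z * (a : ℂ)⁻¹‖ = ‖(a : ℂ) - z‖ * a⁻¹ := by
    intro a ha
    have h1 : (1 : ℂ) - z * (a : ℂ)⁻¹ = ((a : ℂ) - z) * (a : ℂ)⁻¹ := by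
      have : (a : ℂ) ≠ 0 := by exact_mod_cast ha.ne'
      field_simp
    rw [h1, norm_mul, norm_inv, Complex.norm_real, Real.norm_of_nonneg ha.le]
  rw [key ν hν, key κ hκ, Real.exp_add]
  have e1 : 1 + C * ν⁻¹ ≤ Real.exp (C * ν⁻¹) := by
    linarith [Real.add_one_le_exp (C * ν⁻¹)]
  have e2 : 1 + C * ‖(κ : ℂ) - z‖⁻¹ ≤ Real.exp (C * ‖(κ : ℂ) - z‖⁻¹) := by
    linarith [Real.add_one_le_exp (C * ‖(κ : ℂ) - z‖⁻¹)]
  have i1 : ν⁻¹ ≤ (1 + C * ν⁻¹) * κ⁻¹ := by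
    have : κ ≤ ν + C := by linarith [(abs_le.1 hC).1]
    field_simp
    linarith
  have i2 : ‖(ν : ℂ) - z‖ ≤ (1 + C * ‖(κ : ℂ) - z‖⁻¹) * ‖(κ : ℂ) - z‖ := by
    have h1 : ‖(ν : ℂ) - κ‖ ≤ C := by
      rw [← Complex.ofReal_sub, Complex.norm_real]; exact hC
    have h2 : ‖(ν : ℂ) - z‖ ≤ ‖(ν : ℂ) - κ‖ + ‖(κ : ℂ) - z‖ := norm_sub_le_norm_sub_add_norm_sub _ _ _
    have h3 : (1 + C * ‖(κ : ℂ) - z‖⁻¹) * ‖(κ : ℂ) - z‖ = ‖(κ : ℂ) - z‖ + C := by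
      field_simp
    linarith
  have hν' : 0 ≤ ν⁻¹ := (inv_pos.2 hν).le
  calc ‖(ν : ℂ) - z‖ * ν⁻¹
      ≤ ((1 + C * ‖(κ : ℂ) - z‖⁻¹) * ‖(κ : ℂ) - z‖) * ((1 + C * ν⁻¹) * κ⁻¹) := by gcongr
    _ = (1 + C * ν⁻¹) * (1 + C * ‖(κ : ℂ) - z‖⁻¹) * (‖(κ : ℂ) - z‖ * κ⁻¹) := by ring
    _ ≤ _ := by gcongr

/-- Moving the zeros of a product by a bounded amount changes its modulus by a bounded factor at
points `z` at which `∑ 1 / |κ_k - z|` is controlled. -/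
lemma norm_zeroProduct_le_of_close {ν κ : ℕ → ℝ} {C M : ℝ} (hν : ∀ k, 0 < ν k) (hκ : ∀ k, 0 < κ k)
    (hC : ∀ k, |ν k - κ k| ≤ C) (hsν : Summable fun k => (ν k)⁻¹)
    (hsκ : Summable fun k => (κ k)⁻¹) {z : ℂ} (hne : ∀ k, (κ k : ℂ) ≠ z)
    (hz : ∀ K, ∑ k ∈ Finset.range K, ‖(κ k : ℂ) - z‖⁻¹ ≤ M) :
    ‖zeroProduct ν z‖ ≤ Real.exp (C * ∑' k, (ν k)⁻¹ + C * M) * ‖zeroProduct κ z‖ := by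
  have hC0 : 0 ≤ C := (abs_nonneg _).trans (hC 0)
  have t1 := (tendsto_prod_range_linearProduct (summable_norm_inv_ofReal hsν) z).norm
  have t2 := ((tendsto_prod_range_linearProduct (summable_norm_inv_ofReal hsκ) z).norm).const_mul
    (Real.exp (C * ∑' k, (ν k)⁻¹ + C * M))
  refine le_of_tendsto_of_tendsto' t1 t2 fun K => ?_
  rw [norm_prod, norm_prod]
  calc ∏ k ∈ Finset.range K, ‖1 - z * ((ν k : ℂ))⁻¹‖
      ≤ ∏ k ∈ Finset.range K, (Real.exp (C * (ν k)⁻¹ + C * ‖(κ k : ℂ) - z‖⁻¹)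
          * ‖1 - z * ((κ k : ℂ))⁻¹‖) :=
        Finset.prod_le_prod (fun _ _ => norm_nonneg _)
          fun k _ => norm_one_sub_mul_inv_le (hν k) (hκ k) (hC k) (hne k)
    _ = Real.exp (C * ∑ k ∈ Finset.range K, (ν k)⁻¹
          + C * ∑ k ∈ Finset.range K, ‖(κ k : ℂ) - z‖⁻¹)
          * ∏ k ∈ Finset.range K, ‖1 - z * ((κ k : ℂ))⁻¹‖ := by
        rw [Finset.prod_mul_distrib, ← Real.exp_sum, Finset.sum_add_distrib, Finset.mul_sum,
          Finset.mul_sum]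
    _ ≤ _ := by
        gcongr
        · exact hsν.sum_le_tsum _ fun k _ => (inv_pos.2 (hν k)).le
        · exact hz K

/-! ### Dirichlet eigenvalues and their distance to points away from `πℤ` -/

/-- The numbers `π² (k + m + 1)²`: the Dirichlet eigenvalues on the unit interval with the first
`m` of them omitted. -/
def dirichletEigenvalue (m k : ℕ) : ℝ := Real.pi ^ 2 * ((k + m + 1 : ℕ) : ℝ) ^ 2

lemma dirichletEigenvalue_pos (m k : ℕ) : 0 < dirichletEigenvalue m k := by
  unfold dirichletEigenvalue; positivity

lemma summable_inv_dirichletEigenvalue (m : ℕ) :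
    Summable fun k => (dirichletEigenvalue m k)⁻¹ := by
  have h : Summable fun k : ℕ => (((k + (m + 1) : ℕ) : ℝ) ^ 2)⁻¹ :=
    (summable_nat_add_iff (f := fun n : ℕ => ((n : ℝ) ^ 2)⁻¹) (m + 1)).2
      (Real.summable_nat_pow_inv.2 one_lt_two)
  refine (h.mul_left (Real.pi ^ 2)⁻¹).congr fun k => ?_
  rw [dirichletEigenvalue, mul_inv, add_assoc]

lemma summable_inv_of_close {ν κ : ℕ → ℝ} {C : ℝ} (hν : ∀ k, 0 < ν k)
    (hC : ∀ k, |ν k - κ k| ≤ C) (hκ : Tendsto κ atTop atTop)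
    (hs : Summable fun k => (κ k)⁻¹) : Summable fun k => (ν k)⁻¹ := by
  refine Summable.of_norm_bounded_eventually_nat (g := fun k => 2 * (κ k)⁻¹) (hs.mul_left 2) ?_
  filter_upwards [hκ.eventually_ge_atTop (2 * C + 1)] with k hk
  have h1 := (abs_le.1 (hC k)).1
  have hC0 : 0 ≤ C := (abs_nonneg _).trans (hC 0)
  have hν' := hν k
  have hκ' : 0 < κ k := by linarith
  rw [Real.norm_of_nonneg (inv_pos.2 hν').le]
  field_simp
  linarith

lemma tendsto_dirichletEigenvalue (m : ℕ) : Tendsto (dirichletEigenvalue m) atTop atTop := by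
  have h : Tendsto (fun k : ℕ => ((k + (m + 1) : ℕ) : ℝ)) atTop atTop :=
    tendsto_natCast_atTop_atTop.comp (tendsto_add_atTop_nat (m + 1))
  exact ((tendsto_pow_atTop two_ne_zero).comp h).const_mul_atTop (by positivity)

/-- Points of the closed right half-plane at distance at least one from `πℤ`. -/
def AwayFromPi (w : ℂ) : Prop := 0 ≤ w.re ∧ ∀ n : ℤ, 1 ≤ ‖w - Real.pi * n‖

lemma summable_inv_one_add_int_sq : Summable fun l : ℤ => (1 + (l : ℝ) ^ 2)⁻¹ := by
  have h : Summable fun l : ℤ => 1 / (l : ℝ) ^ 2 := Real.summable_one_div_int_pow.2 one_lt_two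
  refine Summable.of_norm_bounded_eventually (g := fun l : ℤ => 1 / (l : ℝ) ^ 2) h ?_
  filter_upwards [eventually_cofinite_ne 0] with l hl
  have hl' : 0 < (l : ℝ) ^ 2 := by positivity
  rw [Real.norm_of_nonneg (by positivity), one_div]
  gcongr
  linarith

lemma norm_pi_sq_mul_sq_sub_sq (w : ℂ) (n : ℕ) :
    ‖((Real.pi ^ 2 * (n : ℝ) ^ 2 : ℝ) : ℂ) - w ^ 2‖
      = ‖w - Real.pi * n‖ * ‖w + Real.pi * n‖ := by
  rw [← norm_mul, ← norm_neg]
  congr 1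
  push_cast
  ring

/-- Since `Re w ≥ 0`, `|π²n² - w²| = |w - πn| |w + πn| ≥ |w - πn|²`. Counting `n` from the integer
part of `Re w / π` makes the bound independent of `w` after summation. -/
lemma AwayFromPi.inv_norm_sub_le {w : ℂ} (hw : AwayFromPi w) (n : ℕ) :
    ‖((Real.pi ^ 2 * (n : ℝ) ^ 2 : ℝ) : ℂ) - w ^ 2‖⁻¹
      ≤ 5 * (1 + (((n : ℤ) - ⌊w.re / Real.pi⌋ : ℤ) : ℝ) ^ 2)⁻¹ := by
  set l : ℤ := (n : ℤ) - ⌊w.re / Real.pi⌋ with hl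
  have hpi := Real.pi_gt_three
  have h1 : 1 ≤ ‖w - Real.pi * n‖ := by simpa using hw.2 n
  have h2 : ‖w - Real.pi * n‖ ≤ ‖w + Real.pi * n‖ := by
    rw [← sq_le_sq₀ (norm_nonneg _) (norm_nonneg _), Complex.sq_norm, Complex.sq_norm,
      Complex.normSq_apply, Complex.normSq_apply]
    have : 0 ≤ w.re * (Real.pi * n) := mul_nonneg hw.1 (by positivity)
    simp
    nlinarith
  have h3 : |w.re - Real.pi * n| ≤ ‖w - Real.pi * n‖ := by
    simpa using Complex.abs_re_le_norm (w - Real.pi * n)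
  have hfl := Int.floor_le (w.re / Real.pi)
  have hfl' := Int.lt_floor_add_one (w.re / Real.pi)
  set u := w.re / Real.pi with hu
  have hre : w.re = Real.pi * u := by rw [hu]; field_simp
  have h4 : |u - n| ≤ ‖w - Real.pi * n‖ := by
    refine le_trans ?_ h3
    rw [hre, ← mul_sub, abs_mul, abs_of_pos Real.pi_pos]
    nlinarith [abs_nonneg (u - n)]
  have hlr : (l : ℝ) = n - ⌊u⌋ := by rw [hl]; push_cast; ring
  -- With `d ≥ 1` and `|l| ≤ 1 + d`, one has `1 + l² ≤ 2 + 2d + d² ≤ 5d²`.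
  have h5 : (1 + (l : ℝ) ^ 2) / 5 ≤ ‖w - Real.pi * n‖ ^ 2 := by
    set d := ‖w - Real.pi * n‖ with hd
    have h6 : |(l : ℝ)| ≤ 1 + d := by
      have : (l : ℝ) = -(u - n) + (u - ⌊u⌋) := by rw [hlr]; ring
      rw [this]
      refine (abs_add_le _ _).trans ?_
      rw [abs_neg, abs_of_nonneg (by linarith : 0 ≤ u - ⌊u⌋)]
      linarith
    have h7 : (l : ℝ) ^ 2 ≤ (1 + d) ^ 2 := by
      rw [← sq_abs]; gcongr
    nlinarith
  have h8 : (1 + (l : ℝ) ^ 2) / 5 ≤ ‖((Real.pi ^ 2 * (n : ℝ) ^ 2 : ℝ) : ℂ) - w ^ 2‖ := by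
    rw [norm_pi_sq_mul_sq_sub_sq]
    nlinarith [norm_nonneg (w - Real.pi * n)]
  have h9 : (0 : ℝ) < (1 + (l : ℝ) ^ 2) / 5 := by positivity
  refine (inv_anti₀ h9 h8).trans_eq ?_
  field_simp

lemma AwayFromPi.norm_le {w : ℂ} (hw : AwayFromPi w) (n : ℕ) :
    ‖w‖ ≤ ‖((Real.pi ^ 2 * (n : ℝ) ^ 2 : ℝ) : ℂ) - w ^ 2‖ := by
  have h1 : 1 ≤ ‖w - Real.pi * n‖ := by simpa using hw.2 n
  have h2 : ‖w‖ ≤ ‖w + Real.pi * n‖ := by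
    rw [← sq_le_sq₀ (norm_nonneg _) (norm_nonneg _), Complex.sq_norm, Complex.sq_norm,
      Complex.normSq_apply, Complex.normSq_apply]
    have h3 : 0 ≤ Real.pi * n := by positivity
    have : 0 ≤ w.re * (Real.pi * n) := mul_nonneg hw.1 h3
    simp
    nlinarith
  rw [norm_pi_sq_mul_sq_sub_sq]
  nlinarith [norm_nonneg (w + Real.pi * n)]

lemma AwayFromPi.sum_inv_le {w : ℂ} (hw : AwayFromPi w) (m K : ℕ) :
    ∑ k ∈ Finset.range K, ‖(dirichletEigenvalue m k : ℂ) - w ^ 2‖⁻¹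
      ≤ 5 * ∑' l : ℤ, (1 + (l : ℝ) ^ 2)⁻¹ := by
  have hinj : Function.Injective fun k : ℕ => ((k + m + 1 : ℕ) : ℤ) - ⌊w.re / Real.pi⌋ := by
    intro a b hab
    simp only [] at hab
    omega
  calc ∑ k ∈ Finset.range K, ‖(dirichletEigenvalue m k : ℂ) - w ^ 2‖⁻¹
      ≤ ∑ k ∈ Finset.range K,
          5 * (1 + ((((k + m + 1 : ℕ) : ℤ) - ⌊w.re / Real.pi⌋ : ℤ) : ℝ) ^ 2)⁻¹ :=
        Finset.sum_le_sum fun k _ => hw.inv_norm_sub_le (k + m + 1)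
    _ = 5 * ∑ l ∈ (Finset.range K).map ⟨_, hinj⟩, (1 + (l : ℝ) ^ 2)⁻¹ := by
        rw [Finset.sum_map, Finset.mul_sum]
        rfl
    _ ≤ _ := by
        gcongr
        exact summable_inv_one_add_int_sq.sum_le_tsum _ fun l _ => by positivity

/-! ### Comparison with Euler's product for the sine -/

/-- The finite product of the first `m` factors of Euler's product for `sin √z / √z`. -/
def initialFactor (m : ℕ) (z : ℂ) : ℂ :=
  ∏ i ∈ Finset.range m, (1 - z / ((Real.pi : ℂ) ^ 2 * ((i : ℂ) + 1) ^ 2))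

/-- Euler's product split after its first `m` factors. -/
lemma mul_initialFactor_mul_zeroProduct (m : ℕ) (w : ℂ) :
    w * initialFactor m (w ^ 2) * zeroProduct (dirichletEigenvalue m) (w ^ 2) = Complex.sin w := by
  have hpi : (Real.pi : ℂ) ≠ 0 := by exact_mod_cast Real.pi_ne_zero
  have t1 := (Complex.tendsto_euler_sin_prod (w / Real.pi)).comp (tendsto_add_atTop_nat m)
  have t2 := (tendsto_prod_range_linearProduct
    (summable_norm_inv_ofReal (summable_inv_dirichletEigenvalue m)) (w ^ 2)).const_mul
      (w * initialFactor m (w ^ 2))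
  rw [mul_div_cancel₀ _ hpi] at t1
  refine tendsto_nhds_unique t2 (t1.congr fun n => ?_)
  simp only [Function.comp_apply]
  rw [add_comm n m, Finset.prod_range_add, ← mul_assoc, initialFactor]
  congr 1
  · congr 1
    refine Finset.prod_congr rfl fun i _ => ?_
    rw [div_pow, div_div]
  · refine Finset.prod_congr rfl fun i _ => ?_
    simp only [dirichletEigenvalue]
    push_cast
    rw [div_pow, div_div, div_eq_mul_inv]
    congr 4
    ring

lemma exists_initialFactor_bounds (m : ℕ) :
    ∃ b B R : ℝ, 0 < b ∧ 0 < B ∧ ∀ z : ℂ, R ≤ ‖z‖ →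
      b * ‖z‖ ^ m ≤ ‖initialFactor m z‖ ∧ ‖initialFactor m z‖ ≤ B * ‖z‖ ^ m := by
  induction m with
  | zero => exact ⟨1, 1, 0, one_pos, one_pos, fun z _ => by simp [initialFactor]⟩
  | succ m ih =>
    obtain ⟨b, B, R, hb, hB, h⟩ := ih
    set a : ℝ := Real.pi ^ 2 * ((m : ℝ) + 1) ^ 2 with ha
    have ha0 : 0 < a := by positivity
    refine ⟨b * (2 * a)⁻¹, B * (2 * a⁻¹), max R (2 * a), by positivity, by positivity,
      fun z hz => ?_⟩
    obtain ⟨h1, h2⟩ := h z ((le_max_left _ _).trans hz)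
    have hza : 2 * a ≤ ‖z‖ := (le_max_right _ _).trans hz
    have hn : ‖z / (a : ℂ)‖ = ‖z‖ * a⁻¹ := by
      rw [norm_div, Complex.norm_real, Real.norm_of_nonneg ha0.le, div_eq_mul_inv]
    have hge : 2 ≤ ‖z‖ * a⁻¹ := by
      rw [← div_eq_mul_inv, le_div_iff₀ ha0]; exact hza
    have hlo : (2 * a)⁻¹ * ‖z‖ ≤ ‖1 - z / (a : ℂ)‖ := by
      have := norm_sub_norm_le (z / (a : ℂ)) 1
      rw [norm_sub_rev, hn, norm_one] at this
      rw [mul_inv]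
      linarith
    have hhi : ‖1 - z / (a : ℂ)‖ ≤ 2 * a⁻¹ * ‖z‖ := by
      have := norm_sub_le 1 (z / (a : ℂ))
      rw [hn, norm_one] at this
      linarith
    have hstep : ‖initialFactor (m + 1) z‖ = ‖initialFactor m z‖ * ‖1 - z / (a : ℂ)‖ := by
      rw [initialFactor, Finset.prod_range_succ, norm_mul, ha]
      push_cast
      rfl
    rw [hstep, pow_succ]
    constructor
    · calc b * (2 * a)⁻¹ * (‖z‖ ^ m * ‖z‖) = (b * ‖z‖ ^ m) * ((2 * a)⁻¹ * ‖z‖) := by ring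
        _ ≤ _ := by gcongr
    · calc ‖initialFactor m z‖ * ‖1 - z / (a : ℂ)‖ ≤ (B * ‖z‖ ^ m) * (2 * a⁻¹ * ‖z‖) := by gcongr
        _ = _ := by ring

/-- A positive sequence within bounded distance of the Dirichlet eigenvalues `π² (k + m + 1)²`. -/
structure IsPerturbedDirichlet (m : ℕ) (ν : ℕ → ℝ) : Prop where
  pos : ∀ k, 0 < ν k
  close : ∃ C, ∀ k, |ν k - dirichletEigenvalue m k| ≤ C

namespace IsPerturbedDirichlet

variable {m : ℕ} {ν : ℕ → ℝ}

lemma summable_inv (h : IsPerturbedDirichlet m ν) : Summable fun k => (ν k)⁻¹ := by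
  obtain ⟨C, hC⟩ := h.close
  exact summable_inv_of_close h.pos hC (tendsto_dirichletEigenvalue m)
    (summable_inv_dirichletEigenvalue m)

lemma differentiable (h : IsPerturbedDirichlet m ν) : Differentiable ℂ (zeroProduct ν) :=
  differentiable_linearProduct (summable_norm_inv_ofReal h.summable_inv)

/-- Two-sided comparison of the product with `sin`, away from the zeros. -/
lemma exists_bounds_away (h : IsPerturbedDirichlet m ν) :
    ∃ b B R : ℝ, 0 < b ∧ 0 < B ∧ ∀ w : ℂ, AwayFromPi w → R ≤ ‖w‖ →
      b * ‖Complex.sin w‖ ≤ ‖w‖ ^ (2 * m + 1) * ‖zeroProduct ν (w ^ 2)‖ ∧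
      ‖w‖ ^ (2 * m + 1) * ‖zeroProduct ν (w ^ 2)‖ ≤ B * ‖Complex.sin w‖ := by
  obtain ⟨C, hC⟩ := h.close
  have hC0 : 0 ≤ C := (abs_nonneg _).trans (hC 0)
  obtain ⟨q, Q, R, hq, hQ, hR⟩ := exists_initialFactor_bounds m
  set S : ℝ := 5 * ∑' l : ℤ, (1 + (l : ℝ) ^ 2)⁻¹ with hS
  set κ := dirichletEigenvalue m with hκ
  set E₁ := Real.exp (C * ∑' k, (ν k)⁻¹ + C * S) with hE₁
  -- The factor `2 * S` reflects that distances from `w²` to `ν k` are only bounded below by half of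
  -- those to `κ k`. The threshold `2 * C ≤ ‖w‖` below guarantees this.
  set E₂ := Real.exp (C * ∑' k, (κ k)⁻¹ + C * (2 * S)) with hE₂
  refine ⟨Q⁻¹ * E₂⁻¹, q⁻¹ * E₁, max (max R 1) (2 * C), by positivity, by positivity,
    fun w hw hwR => ?_⟩
  have hw1 : 1 ≤ ‖w‖ := (le_max_right _ _).trans ((le_max_left _ _).trans hwR)
  have hwC : 2 * C ≤ ‖w‖ := (le_max_right _ _).trans hwR
  have hwR' : R ≤ ‖w ^ 2‖ := by
    have : R ≤ ‖w‖ := (le_max_left _ _).trans ((le_max_left _ _).trans hwR)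
    rw [norm_pow]
    nlinarith
  have hdist : ∀ k, ‖w‖ ≤ ‖(κ k : ℂ) - w ^ 2‖ := fun k => hw.norm_le (k + m + 1)
  have hhalf : ∀ k, ‖(κ k : ℂ) - w ^ 2‖ / 2 ≤ ‖(ν k : ℂ) - w ^ 2‖ := by
    intro k
    have h1 : ‖(κ k : ℂ) - ν k‖ ≤ C := by
      rw [← Complex.ofReal_sub, Complex.norm_real, Real.norm_eq_abs, abs_sub_comm]
      exact hC k
    have h2 := norm_sub_le_norm_sub_add_norm_sub (κ k : ℂ) (ν k) (w ^ 2)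
    have h3 := hdist k
    linarith
  have up : ‖zeroProduct ν (w ^ 2)‖ ≤ E₁ * ‖zeroProduct κ (w ^ 2)‖ := by
    refine norm_zeroProduct_le_of_close h.pos (dirichletEigenvalue_pos m) hC h.summable_inv
      (summable_inv_dirichletEigenvalue m) (fun k hk => ?_) (fun K => hw.sum_inv_le m K)
    have := hdist k
    rw [← hκ] at hk
    rw [hk, sub_self, norm_zero] at this
    linarith
  have lo : ‖zeroProduct κ (w ^ 2)‖ ≤ E₂ * ‖zeroProduct ν (w ^ 2)‖ := by
    refine norm_zeroProduct_le_of_close (dirichletEigenvalue_pos m) h.pos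
      (fun k => by rw [abs_sub_comm]; exact hC k)
      (summable_inv_dirichletEigenvalue m) h.summable_inv (fun k hk => ?_) (fun K => ?_)
    · have h1 := hdist k
      have h2 := hhalf k
      rw [hk, sub_self, norm_zero] at h2
      linarith
    · refine le_trans ?_ (mul_le_mul_of_nonneg_left (hw.sum_inv_le m K) zero_le_two)
      rw [Finset.mul_sum]
      refine Finset.sum_le_sum fun k _ => ?_
      have h1 := hdist k
      have h2 : 0 < ‖(κ k : ℂ) - w ^ 2‖ / 2 := by linarith
      refine (inv_anti₀ h2 (hhalf k)).trans_eq ?_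
      rw [inv_div, div_eq_mul_inv]
  have hsin : ‖w‖ * ‖initialFactor m (w ^ 2)‖ * ‖zeroProduct κ (w ^ 2)‖ = ‖Complex.sin w‖ := by
    rw [← mul_initialFactor_mul_zeroProduct m w, norm_mul, norm_mul]
  obtain ⟨i1, i2⟩ := hR (w ^ 2) hwR'
  have hpow : ‖w ^ 2‖ ^ m * ‖w‖ = ‖w‖ ^ (2 * m + 1) := by
    rw [norm_pow, ← pow_mul, ← pow_succ]
  rw [← hpow, ← hsin]
  have hE₁0 : 0 < E₁ := Real.exp_pos _
  have hE₂0 : 0 < E₂ := Real.exp_pos _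
  constructor
  · calc Q⁻¹ * E₂⁻¹ * (‖w‖ * ‖initialFactor m (w ^ 2)‖ * ‖zeroProduct κ (w ^ 2)‖)
        ≤ Q⁻¹ * E₂⁻¹ * (‖w‖ * (Q * ‖w ^ 2‖ ^ m) * (E₂ * ‖zeroProduct ν (w ^ 2)‖)) := by gcongr
      _ = _ := by field_simp
  · calc ‖w ^ 2‖ ^ m * ‖w‖ * ‖zeroProduct ν (w ^ 2)‖
        = q⁻¹ * (‖w‖ * (q * ‖w ^ 2‖ ^ m) * ‖zeroProduct ν (w ^ 2)‖) := by field_simp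
      _ ≤ q⁻¹ * (‖w‖ * ‖initialFactor m (w ^ 2)‖ * (E₁ * ‖zeroProduct κ (w ^ 2)‖)) := by gcongr
      _ = _ := by ring

end IsPerturbedDirichlet

/-! ### Upper and lower bounds for the sine -/

lemma norm_sin_le_exp (w : ℂ) : ‖Complex.sin w‖ ≤ Real.exp |w.im| := by
  have h1 : ‖Complex.exp (-w * Complex.I)‖ ≤ Real.exp |w.im| := by
    rw [Complex.norm_exp]
    simpa using le_abs_self w.im
  have h2 : ‖Complex.exp (w * Complex.I)‖ ≤ Real.exp |w.im| := by
    rw [Complex.norm_exp]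
    simpa using neg_le_abs w.im
  have h3 := norm_sub_le (Complex.exp (-w * Complex.I)) (Complex.exp (w * Complex.I))
  rw [Complex.sin, norm_div, norm_mul, Complex.norm_I, mul_one, Complex.norm_ofNat]
  linarith

lemma one_half_le_abs_sin {x : ℝ} {n : ℕ} (hx : |x - (n + 1 / 2) * Real.pi| ≤ 1 / 2) :
    1 / 2 ≤ |Real.sin x| := by
  set d := x - (n + 1 / 2) * Real.pi with hd
  have hxd : x = (d + Real.pi / 2) + n * Real.pi := by rw [hd]; ring
  rw [hxd, Real.sin_add_nat_mul_pi, abs_mul, abs_pow, abs_neg, abs_one, one_pow, one_mul,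
    Real.sin_add_pi_div_two]
  have h1 := Real.one_sub_sq_div_two_le_cos (x := d)
  have h2 : d ^ 2 ≤ (1 / 2) ^ 2 := by rw [← sq_abs]; gcongr
  refine le_trans ?_ (le_abs_self _)
  linarith

lemma exp_le_norm_sin_of_one_le {w : ℂ} (hw : 1 ≤ |w.im|) :
    Real.exp |w.im| / 4 ≤ ‖Complex.sin w‖ := by
  have h0 : Real.exp (-|w.im|) ≤ Real.exp |w.im| / 2 := by
    have h1 : 2 ≤ Real.exp |w.im| := by linarith [Real.add_one_le_exp |w.im|]
    have h2 : Real.exp (-|w.im|) ≤ 1 := by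
      rw [Real.exp_le_one_iff]; linarith
    linarith
  have e1 : ‖Complex.exp (-w * Complex.I)‖ = Real.exp w.im := by
    rw [Complex.norm_exp]; simp
  have e2 : ‖Complex.exp (w * Complex.I)‖ = Real.exp (-w.im) := by
    rw [Complex.norm_exp]; simp
  have h3 := abs_norm_sub_norm_le (Complex.exp (-w * Complex.I)) (Complex.exp (w * Complex.I))
  rw [e1, e2] at h3
  have h4 : Real.exp |w.im| / 2 ≤ |Real.exp w.im - Real.exp (-w.im)| := by
    rcases le_total 0 w.im with h | h
    · rw [abs_of_nonneg h] at h0 ⊢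
      refine le_trans ?_ (le_abs_self _)
      linarith
    · rw [abs_of_nonpos h, neg_neg] at h0
      rw [abs_of_nonpos h]
      refine le_trans ?_ (neg_le_abs _)
      linarith
  rw [Complex.sin, norm_div, norm_mul, Complex.norm_I, mul_one, Complex.norm_ofNat]
  linarith

lemma abs_sin_re_mul_exp_le_norm_sin (w : ℂ) :
    |Real.sin w.re| * (Real.exp |w.im| / 2) ≤ ‖Complex.sin w‖ := by
  have h1 := Complex.abs_re_le_norm (Complex.sin w)
  have h2 : (Complex.sin w).re = Real.sin w.re * Real.cosh w.im := by
    rw [Complex.sin_eq w, ← Complex.ofReal_sin, ← Complex.ofReal_cosh, ← Complex.ofReal_cos,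
      ← Complex.ofReal_sinh]
    simp only [Complex.add_re, Complex.mul_re, Complex.mul_im, Complex.ofReal_re,
      Complex.ofReal_im, Complex.I_re, Complex.I_im]
    ring
  rw [h2, abs_mul] at h1
  refine le_trans ?_ h1
  gcongr
  rw [← Real.cosh_abs w.im, abs_of_pos (Real.cosh_pos _), Real.cosh_eq]
  linarith [Real.exp_pos (-|w.im|)]

lemma awayFromPi_of_norm_eq {w : ℂ} {n : ℕ} (hre : 0 ≤ w.re)
    (hw : ‖w‖ = (n + 1 / 2) * Real.pi) : AwayFromPi w := by
  refine ⟨hre, fun k => ?_⟩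
  have h1 := abs_norm_sub_norm_le w (Real.pi * k)
  have hpi := Real.pi_gt_three
  have h2 : ‖(Real.pi * k : ℂ)‖ = (|k| : ℤ) * Real.pi := by
    rw [norm_mul, Complex.norm_real, Real.norm_of_nonneg Real.pi_pos.le, Complex.norm_intCast,
      mul_comm]
    simp
  rw [h2, hw, ← sub_mul, abs_mul, abs_of_pos Real.pi_pos] at h1
  have h3 : (1 : ℝ) / 2 ≤ |(n : ℝ) + 1 / 2 - (|k| : ℤ)| := by
    rcases le_or_gt |k| (n : ℤ) with h | h
    · have : ((|k| : ℤ) : ℝ) ≤ n := by exact_mod_cast h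
      refine le_trans ?_ (le_abs_self _)
      linarith
    · have : (n : ℝ) + 1 ≤ ((|k| : ℤ) : ℝ) := by exact_mod_cast h
      refine le_trans ?_ (neg_le_abs _)
      linarith
  nlinarith

/-- If `|Im w| ≥ 1`, one exponential in the sine dominates. Otherwise the circle is so large that
`Re w` lies within `1/2` of `(n + 1/2)π`, where the real sine is at least `1/2`. -/
lemma exp_le_norm_sin_of_norm_eq {w : ℂ} {n : ℕ} (hn : 1 ≤ n) (hre : 0 ≤ w.re)
    (hw : ‖w‖ = (n + 1 / 2) * Real.pi) : Real.exp |w.im| / 4 ≤ ‖Complex.sin w‖ := by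
  rcases le_total 1 |w.im| with h | h
  · exact exp_le_norm_sin_of_one_le h
  · have hn' : (1 : ℝ) ≤ n := by exact_mod_cast hn
    have hpi := Real.pi_gt_three
    have hbig : 4 ≤ ‖w‖ := by rw [hw]; nlinarith
    have hsq : ‖w‖ ^ 2 = w.re ^ 2 + w.im ^ 2 := by
      rw [Complex.sq_norm, Complex.normSq_apply]; ring
    have him : w.im ^ 2 ≤ 1 := by rw [← sq_abs]; nlinarith [abs_nonneg w.im]
    have hle := Complex.re_le_norm w
    have hx : |w.re - (n + 1 / 2) * Real.pi| ≤ 1 / 2 := by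
      rw [← hw, abs_of_nonpos (by linarith)]
      nlinarith
    have h1 := one_half_le_abs_sin hx
    have h2 := abs_sin_re_mul_exp_le_norm_sin w
    nlinarith [Real.exp_pos |w.im|]

lemma awayFromPi_ofReal {x : ℝ} {n : ℕ} (hx : |x - (n + 1 / 2) * Real.pi| ≤ 1 / 2) :
    AwayFromPi (x : ℂ) := by
  have hpi := Real.pi_gt_three
  have hn : (0 : ℝ) ≤ n := n.cast_nonneg
  obtain ⟨h1, h2⟩ := abs_le.1 hx
  have hx0 : 0 ≤ x := by nlinarith
  refine ⟨by simpa using hx0, fun k => ?_⟩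
  have : ((x : ℂ) - Real.pi * k) = ((x - Real.pi * k : ℝ) : ℂ) := by push_cast; ring
  rw [this, Complex.norm_real, Real.norm_eq_abs]
  rcases le_or_gt k (n : ℤ) with h | h
  · have : (k : ℝ) ≤ n := by exact_mod_cast h
    refine le_trans ?_ (le_abs_self _)
    nlinarith
  · have : (n : ℝ) + 1 ≤ k := by exact_mod_cast h
    refine le_trans ?_ (neg_le_abs _)
    nlinarith

/-! ### Growth of the product in the whole right half-plane -/

namespace IsPerturbedDirichlet

variable {m : ℕ} {ν : ℕ → ℝ}

/-- The growth of the product in the whole right half-plane of the variable `w = √z`. -/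
lemma exists_upper_bound (h : IsPerturbedDirichlet m ν) :
    ∃ B R : ℝ, 0 < B ∧ ∀ w : ℂ, 0 ≤ w.re → R ≤ ‖w‖ →
      ‖w‖ ^ (2 * m + 1) * ‖zeroProduct ν (w ^ 2)‖ ≤ B * Real.exp |w.im| := by
  obtain ⟨b, B, R, -, hB, hR⟩ := h.exists_bounds_away
  -- Near a point `a` of `πℤ` the bound is carried over from the unit circle about `a` by the
  -- maximum principle. There `‖v‖ ≥ ‖w‖ - 2`, which is at least `R` and at least `‖w‖ / 2`; the
  -- latter produces the power of `2`. The threshold `10` keeps the circle in the right half-plane.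
  refine ⟨2 ^ (2 * m + 1) * (B * Real.exp 1), max (R + 2) 10, by positivity, fun w hre hw => ?_⟩
  have hwR : R + 2 ≤ ‖w‖ := (le_max_left _ _).trans hw
  have hw10 : 10 ≤ ‖w‖ := (le_max_right _ _).trans hw
  have hpi := Real.pi_gt_three
  have hexp : 1 ≤ Real.exp |w.im| := Real.one_le_exp (abs_nonneg _)
  by_cases haway : AwayFromPi w
  · refine ((hR w haway (by linarith)).2.trans
      (mul_le_mul_of_nonneg_left (norm_sin_le_exp w) hB.le)).trans ?_
    gcongr
    have h1 : (1 : ℝ) ≤ 2 ^ (2 * m + 1) := one_le_pow₀ one_le_two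
    have h2 : 1 ≤ Real.exp 1 := Real.one_le_exp zero_le_one
    nlinarith [mul_le_mul h1 h2 zero_le_one (by positivity)]
  · obtain ⟨n, hn⟩ : ∃ n : ℤ, ‖w - Real.pi * n‖ < 1 := by
      by_contra! hcon
      exact haway ⟨hre, hcon⟩
    set a : ℂ := Real.pi * n with ha
    have hnorm_a : ‖w‖ - 1 ≤ ‖a‖ := by
      have := norm_sub_norm_le w a
      linarith
    have hre_a : 8 ≤ a.re := by
      have h1 : |(w - a).re| ≤ ‖w - a‖ := Complex.abs_re_le_norm _
      have h2 : |(w - a).im| ≤ ‖w - a‖ := Complex.abs_im_le_norm _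
      have h3 : a.im = 0 := by simp [ha]
      rw [Complex.sub_im, h3, sub_zero] at h2
      rw [Complex.sub_re] at h1
      have h4 := Complex.norm_le_abs_re_add_abs_im w
      rw [abs_of_nonneg hre] at h4
      linarith [(abs_le.1 h1).2]
    have hsph : ∀ v : ℂ, ‖v - a‖ = 1 →
        ‖zeroProduct ν (v ^ 2)‖ ≤ B * Real.exp 1 / (‖w‖ / 2) ^ (2 * m + 1) := by
      intro v hv
      have hvaway : AwayFromPi v := by
        constructor
        · have h1 : |(v - a).re| ≤ ‖v - a‖ := Complex.abs_re_le_norm _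
          rw [Complex.sub_re, hv] at h1
          linarith [(abs_le.1 h1).1]
        · intro k
          by_cases hk : k = n
          · rw [hk, ← ha, hv]
          · have h1 : (1 : ℝ) ≤ |(n : ℝ) - k| := by
              have : (1 : ℤ) ≤ |n - k| := Int.one_le_abs (sub_ne_zero.2 (Ne.symm hk))
              exact_mod_cast this
            have h2 : ‖a - Real.pi * k‖ = Real.pi * |(n : ℝ) - k| := by
              have : a - Real.pi * k = ((Real.pi * ((n : ℝ) - k) : ℝ) : ℂ) := by
                rw [ha]; push_cast; ring
              rw [this, Complex.norm_real, Real.norm_eq_abs, abs_mul, abs_of_pos Real.pi_pos]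
            have h3 := norm_sub_le_norm_sub_add_norm_sub a v (Real.pi * k)
            rw [norm_sub_rev a v, hv] at h3
            nlinarith
      have hvn : ‖w‖ - 2 ≤ ‖v‖ := by
        have := norm_sub_norm_le a v
        rw [norm_sub_rev, hv] at this
        linarith
      have him : |v.im| ≤ 1 := by
        have h2 : |(v - a).im| ≤ ‖v - a‖ := Complex.abs_im_le_norm _
        have h3 : a.im = 0 := by simp [ha]
        rwa [Complex.sub_im, h3, sub_zero, hv] at h2
      have hb := (hR v hvaway (by linarith)).2
      rw [le_div_iff₀ (by positivity), mul_comm]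
      calc (‖w‖ / 2) ^ (2 * m + 1) * ‖zeroProduct ν (v ^ 2)‖
          ≤ ‖v‖ ^ (2 * m + 1) * ‖zeroProduct ν (v ^ 2)‖ := by
            gcongr
            linarith
        _ ≤ B * ‖Complex.sin v‖ := hb
        _ ≤ B * Real.exp |v.im| := by
            gcongr
            exact norm_sin_le_exp v
        _ ≤ B * Real.exp 1 := by gcongr
    have hd : Differentiable ℂ fun v : ℂ => zeroProduct ν (v ^ 2) :=
      h.differentiable.comp (differentiable_id.pow 2)
    have hmax := Complex.norm_le_of_forall_mem_frontier_norm_le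
      (Metric.isBounded_ball (x := a) (r := 1)) hd.diffContOnCl
      (fun v hv => hsph v (by
        rw [frontier_ball a one_ne_zero] at hv
        simpa [dist_eq_norm] using hv))
      (subset_closure (show w ∈ Metric.ball a 1 by simpa [dist_eq_norm] using hn))
    calc ‖w‖ ^ (2 * m + 1) * ‖zeroProduct ν (w ^ 2)‖
        ≤ ‖w‖ ^ (2 * m + 1) * (B * Real.exp 1 / (‖w‖ / 2) ^ (2 * m + 1)) := by gcongr
      _ = 2 ^ (2 * m + 1) * (B * Real.exp 1) * 1 := by
          rw [div_pow]
          field_simp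
      _ ≤ _ := by gcongr

end IsPerturbedDirichlet

/-! ### Square roots, polynomial bounds and a divergent integral -/

lemma cpow_half_sq (z : ℂ) : (z ^ (1 / 2 : ℂ)) ^ 2 = z := by
  simp

lemma cpow_half_re_nonneg (z : ℂ) : 0 ≤ (z ^ (1 / 2 : ℂ)).re := by
  by_cases hz : z = 0
  · simp [hz]
  · rw [Complex.cpow_def_of_ne_zero hz, Complex.exp_re]
    have him : (Complex.log z * (1 / 2)).im = z.arg / 2 := by
      have : (1 / 2 : ℂ) = ((1 / 2 : ℝ) : ℂ) := by push_cast; rfl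
      rw [this, Complex.im_mul_ofReal, Complex.log_im]
      ring
    rw [him]
    refine mul_nonneg (Real.exp_pos _).le (Real.cos_nonneg_of_mem_Icc ⟨?_, ?_⟩)
    · linarith [Complex.neg_pi_lt_arg z]
    · linarith [Complex.arg_le_pi z]

lemma norm_cpow_half_sq (z : ℂ) : ‖z ^ (1 / 2 : ℂ)‖ ^ 2 = ‖z‖ := by
  rw [← norm_pow, cpow_half_sq]

lemma norm_mul_norm_sum_le (a : ℕ → ℂ) (m : ℕ) {z : ℂ} (hz : 1 ≤ ‖z‖) :
    ‖z‖ * ‖∑ k ∈ Finset.range m, a k * z ^ k‖ ≤ (∑ k ∈ Finset.range m, ‖a k‖) * ‖z‖ ^ m := by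
  calc ‖z‖ * ‖∑ k ∈ Finset.range m, a k * z ^ k‖
      ≤ ‖z‖ * ∑ k ∈ Finset.range m, ‖a k‖ * ‖z‖ ^ k := by
        gcongr
        refine (norm_sum_le _ _).trans_eq ?_
        simp
    _ = ∑ k ∈ Finset.range m, ‖a k‖ * ‖z‖ ^ (k + 1) := by
        rw [Finset.mul_sum]
        exact Finset.sum_congr rfl fun k _ => by ring
    _ ≤ ∑ k ∈ Finset.range m, ‖a k‖ * ‖z‖ ^ m := by
        refine Finset.sum_le_sum fun k hk => ?_
        have : k + 1 ≤ m := by simpa using hk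
        gcongr
    _ = _ := by rw [Finset.sum_mul]

/-- A polynomial of degree `m` is eventually bounded below by a multiple of `|z| ^ m`. -/
lemma exists_norm_sum_ge {a : ℕ → ℂ} {m : ℕ} (ham : a m ≠ 0) :
    ∃ R : ℝ, ∀ z : ℂ, R ≤ ‖z‖ →
      ‖a m‖ / 2 * ‖z‖ ^ m ≤ ‖∑ k ∈ Finset.range (m + 1), a k * z ^ k‖ := by
  have ha : 0 < ‖a m‖ := norm_pos_iff.2 ham
  set S := ∑ k ∈ Finset.range m, ‖a k‖ with hS
  refine ⟨max 1 (2 * S / ‖a m‖), fun z hz => ?_⟩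
  have h1 : 1 ≤ ‖z‖ := (le_max_left _ _).trans hz
  have h2 : 2 * S ≤ ‖z‖ * ‖a m‖ := (div_le_iff₀ ha).1 ((le_max_right _ _).trans hz)
  have h3 := norm_mul_norm_sum_le a m h1
  rw [← hS] at h3
  have hzm : 0 < ‖z‖ ^ m := by positivity
  have h4 : ‖∑ k ∈ Finset.range m, a k * z ^ k‖ ≤ ‖a m‖ / 2 * ‖z‖ ^ m := by
    have h5 : S * ‖z‖ ^ m ≤ ‖z‖ * (‖a m‖ / 2 * ‖z‖ ^ m) := by nlinarith
    exact le_of_mul_le_mul_left (h3.trans h5) (by linarith)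
  rw [Finset.sum_range_succ]
  have h6 := norm_sub_norm_le (a m * z ^ m) (-∑ k ∈ Finset.range m, a k * z ^ k)
  rw [norm_neg, sub_neg_eq_add, norm_mul, norm_pow, add_comm (a m * z ^ m)] at h6
  linarith

/-- The function `1 / t` has infinite integral over the union of the intervals
`[((n + 1/2) π - 1/2)², ((n + 1/2) π + 1/2)²]`. -/
lemma not_integrableOn_of_ge_div {φ : ℝ → ℝ} {β : ℝ} (hβ : 0 < β) {n₀ : ℕ}
    (hφ : ∀ n ≥ n₀, ∀ x : ℝ, |x - (n + 1 / 2) * Real.pi| ≤ 1 / 2 → β / x ^ 2 ≤ φ (x ^ 2)) :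
    ¬ IntegrableOn φ (Set.Ioi 0) := by
  intro hint
  have hpi := Real.pi_gt_three
  set c : ℕ → ℝ := fun n => ((n + n₀ : ℕ) + 1 / 2) * Real.pi with hc
  have hc1 : ∀ n, 3 / 2 ≤ c n := by
    intro n
    have : (0 : ℝ) ≤ ((n + n₀ : ℕ) : ℝ) := Nat.cast_nonneg _
    simp only [hc]
    nlinarith
  set I : ℕ → Set ℝ := fun n => Set.Ioc ((c n - 1 / 2) ^ 2) ((c n + 1 / 2) ^ 2) with hI
  have hdisj : Pairwise (Function.onFun Disjoint I) := by
    rw [pairwise_disjoint_on]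
    intro a b hab
    have h1 : c a + 1 / 2 ≤ c b - 1 / 2 := by
      have : ((a + n₀ : ℕ) : ℝ) + 1 ≤ ((b + n₀ : ℕ) : ℝ) := by
        exact_mod_cast (by omega : a + n₀ + 1 ≤ b + n₀)
      simp only [hc]
      nlinarith
    have h2 : (c a + 1 / 2) ^ 2 ≤ (c b - 1 / 2) ^ 2 := by
      have := hc1 a
      gcongr
    exact Set.Ioc_disjoint_Ioc_of_le h2
  have hsub : (⋃ n, I n) ⊆ Set.Ioi 0 := by
    refine Set.iUnion_subset fun n t ht => ?_
    exact lt_of_le_of_lt (sq_nonneg _) ht.1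
  have hsum := (hasSum_integral_iUnion (f := φ) (μ := volume) (s := I)
    (fun n => measurableSet_Ioc) hdisj (hint.mono_set hsub)).summable
  -- The interval `I n` has length `2 * c n`, and `φ` is at least `β / (c n + 1/2)²` on it, so the
  -- integrals dominate a harmonic series.
  have hlow : ∀ n : ℕ, β / 4 * (1 / ((n + (n₀ + 1) : ℕ) : ℝ)) ≤ ∫ t in I n, φ t := by
    intro n
    have hcn := hc1 n
    have hlb : ∀ t ∈ I n, β / (c n + 1 / 2) ^ 2 ≤ φ t := by
      intro t ht
      have ht0 : 0 < t := hsub (Set.mem_iUnion.2 ⟨n, ht⟩)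
      have hs : √t ^ 2 = t := Real.sq_sqrt ht0.le
      have h1 : c n - 1 / 2 ≤ √t := Real.le_sqrt_of_sq_le ht.1.le
      have h2 : √t ≤ c n + 1 / 2 := Real.sqrt_le_left (by linarith) |>.2 ht.2
      have h3 := hφ (n + n₀) (by omega) √t (by
        change |√t - c n| ≤ 1 / 2
        rw [abs_le]
        constructor <;> linarith)
      rw [hs] at h3
      refine le_trans ?_ h3
      have := ht.2
      gcongr
    have h4 := setIntegral_ge_of_const_le_real (μ := volume) measurableSet_Ioc
      (by simp) hlb (hint.mono_set ((Set.subset_iUnion I n).trans hsub))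
    refine le_trans ?_ h4
    have hvol : volume.real (I n) = 2 * c n := by
      rw [hI, Real.volume_real_Ioc_of_le (by nlinarith)]
      ring
    rw [hvol]
    have h5 : c n + 1 / 2 ≤ 4 * ((n + (n₀ + 1) : ℕ) : ℝ) := by
      have h0 : (0 : ℝ) ≤ ((n + n₀ : ℕ) : ℝ) := Nat.cast_nonneg _
      have : ((n + (n₀ + 1) : ℕ) : ℝ) = ((n + n₀ : ℕ) : ℝ) + 1 := by push_cast; ring
      rw [this]
      simp only [hc]
      nlinarith [Real.pi_lt_d2]
    calc β / 4 * (1 / ((n + (n₀ + 1) : ℕ) : ℝ)) = β / (4 * ((n + (n₀ + 1) : ℕ) : ℝ)) := by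
          field_simp
      _ ≤ β / (c n + 1 / 2) := by gcongr
      _ ≤ β / (c n + 1 / 2) ^ 2 * (2 * c n) := by
          rw [div_mul_eq_mul_div, div_le_div_iff₀ (by linarith) (by positivity)]
          have : c n + 1 / 2 ≤ 2 * c n := by linarith
          nlinarith [mul_le_mul_of_nonneg_left this (mul_pos hβ (by linarith : 0 < c n + 1 / 2)).le]
  have hs2 : Summable fun n : ℕ => β / 4 * (1 / ((n + (n₀ + 1) : ℕ) : ℝ)) :=
    hsum.of_nonneg_of_le (fun n => by positivity) hlow
  rw [summable_mul_left_iff (by positivity)] at hs2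
  exact Real.not_summable_one_div_natCast
    ((summable_nat_add_iff (f := fun n : ℕ => 1 / (n : ℝ)) (n₀ + 1)).1 hs2)

/-! ### Admissible multiples of the product are products with polynomials of degree less than `m` -/

namespace IsPerturbedDirichlet

variable {m : ℕ} {ν : ℕ → ℝ}

lemma zeroProduct_apply_eq_zero (h : IsPerturbedDirichlet m ν) (k : ℕ) :
    zeroProduct ν (ν k) = 0 :=
  linearProduct_eq_zero (summable_norm_inv_ofReal h.summable_inv) (k := k)
    (mul_inv_cancel₀ (by exact_mod_cast (h.pos k).ne'))

lemma exists_eq_of_zeroProduct_eq_zero (h : IsPerturbedDirichlet m ν) {z : ℂ}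
    (hz : zeroProduct ν z = 0) : ∃ k, z = ν k := by
  by_contra! hcon
  refine linearProduct_ne_zero (summable_norm_inv_ofReal h.summable_inv) (fun k hk => ?_) hz
  have hne : (ν k : ℂ) ≠ 0 := by exact_mod_cast (h.pos k).ne'
  exact hcon k (by rw [← div_eq_mul_inv, div_eq_one_iff_eq hne] at hk; exact hk)

/-- An entire function of exponential type one in `√z` that vanishes at the zeros of the product
is the product of `zeroProduct ν` and a polynomial of degree at most `m`. -/
lemma exists_polynomial_factor (h : IsPerturbedDirichlet m ν) (hinj : Function.Injective ν)
    {η : ℂ → ℂ} (hη : Differentiable ℂ η)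
    (hgrowth : η =O[Bornology.cobounded ℂ] fun z : ℂ => Real.exp |(z ^ (1 / 2 : ℂ)).im|)
    (hzero : ∀ k, η (ν k) = 0) :
    ∃ a : ℕ → ℂ, ∀ z, η z = zeroProduct ν z * ∑ k ∈ Finset.range (m + 1), a k * z ^ k := by
  have hinj' : Function.Injective fun k => ((ν k : ℂ))⁻¹ := fun i j hij =>
    hinj (by exact_mod_cast inv_injective hij)
  obtain ⟨g, hg, hfac⟩ := exists_entire_quotient h.differentiable hη
    (fun a ha => deriv_linearProduct_ne_zero (summable_norm_inv_ofReal h.summable_inv) hinj' ha)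
    (fun a ha => by
      obtain ⟨k, rfl⟩ := h.exists_eq_of_zeroProduct_eq_zero ha
      exact hzero k)
  obtain ⟨b, B, R, hb, -, hR⟩ := h.exists_bounds_away
  obtain ⟨K, hK⟩ := hgrowth.bound
  rw [← comap_norm_atTop, eventually_comap] at hK
  obtain ⟨R', hR'⟩ := eventually_atTop.1 hK
  have hr : Tendsto (fun n : ℕ => ((n : ℝ) + 1 / 2) * Real.pi) atTop atTop :=
    (tendsto_atTop_add_const_right _ _ tendsto_natCast_atTop_atTop).atTop_mul_const Real.pi_pos
  suffices ∃ a : ℕ → ℂ, ∀ z, g z = ∑ k ∈ Finset.range (m + 1), a k * z ^ k by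
    obtain ⟨a, ha⟩ := this
    exact ⟨a, fun z => by rw [hfac, ha]⟩
  refine exists_polynomial_of_growth hg m
    (R := fun n : ℕ => (((n : ℝ) + 1 / 2) * Real.pi) ^ 2)
    -- `K` comes from the growth of `η`, `4` from the sine bound on the circles and `1 / b` from the
    -- lower bound for the product.
    (M := fun n : ℕ => 4 * K / b * (((n : ℝ) + 1 / 2) * Real.pi) ^ (2 * m + 1))
    ((tendsto_pow_atTop two_ne_zero).comp hr) ?_ ?_
  · have : Tendsto (fun n : ℕ => 4 * K / b * (((n : ℝ) + 1 / 2) * Real.pi)⁻¹) atTop (𝓝 0) := by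
      simpa using (tendsto_inv_atTop_zero.comp hr).const_mul (4 * K / b)
    refine this.congr fun n => ?_
    have : 0 < ((n : ℝ) + 1 / 2) * Real.pi := by positivity
    generalize ((n : ℝ) + 1 / 2) * Real.pi = r at this
    field_simp
    ring
  · filter_upwards [hr.eventually_ge_atTop R, eventually_ge_atTop 1,
      ((tendsto_pow_atTop two_ne_zero).comp hr).eventually_ge_atTop R'] with n hn hn1 hn'
    intro z hz
    set w := z ^ (1 / 2 : ℂ) with hw
    have hwz : w ^ 2 = z := cpow_half_sq z
    have hre : 0 ≤ w.re := cpow_half_re_nonneg z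
    have hwn : ‖w‖ = ((n : ℝ) + 1 / 2) * Real.pi := by
      have h1 : ‖w‖ ^ 2 = (((n : ℝ) + 1 / 2) * Real.pi) ^ 2 := (norm_cpow_half_sq z).trans hz
      exact (pow_left_inj₀ (norm_nonneg _) (by positivity) two_ne_zero).1 h1
    have h1 := (hR w (awayFromPi_of_norm_eq hre hwn) (by rw [hwn]; exact hn)).1
    have h2 := exp_le_norm_sin_of_norm_eq hn1 hre hwn
    have h3 := hR' ‖z‖ (by rw [hz]; exact hn') z rfl
    rw [hwz] at h1
    rw [Real.norm_of_nonneg (Real.exp_pos _).le, ← hw, hfac, norm_mul] at h3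
    have he := Real.exp_pos |w.im|
    have h4 : Real.exp |w.im| ≤ 4 / b * (‖w‖ ^ (2 * m + 1) * ‖zeroProduct ν z‖) := by
      rw [div_mul_eq_mul_div, le_div_iff₀ hb]
      nlinarith
    have hfpos : 0 < ‖zeroProduct ν z‖ := by
      refine (norm_nonneg _).lt_of_ne fun h0 => ?_
      rw [← h0] at h4
      simp at h4
      linarith
    have hK0 : 0 ≤ K := by
      by_contra hneg
      have := mul_neg_of_neg_of_pos (not_le.1 hneg) he
      have := mul_nonneg (norm_nonneg (zeroProduct ν z)) (norm_nonneg (g z))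
      linarith
    refine le_of_mul_le_mul_left (a := ‖zeroProduct ν z‖) ?_ hfpos
    calc ‖zeroProduct ν z‖ * ‖g z‖ ≤ K * Real.exp |w.im| := h3
      _ ≤ K * (4 / b * (‖w‖ ^ (2 * m + 1) * ‖zeroProduct ν z‖)) := by gcongr
      _ = _ := by rw [← hwn]; ring

/-- The product times a polynomial of degree exactly `m` is not square integrable. -/
lemma leadingCoeff_eq_zero_of_memLp (h : IsPerturbedDirichlet m ν) {a : ℕ → ℂ}
    (hmem : MemLp (fun t : ℝ => zeroProduct ν t * ∑ k ∈ Finset.range (m + 1), a k * (t : ℂ) ^ k) 2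
      (volume.restrict (Set.Ioi (0 : ℝ)))) : a m = 0 := by
  by_contra ham
  obtain ⟨R₁, hR₁⟩ := exists_norm_sum_ge ham
  obtain ⟨b, B, R₂, hb, -, hR₂⟩ := h.exists_bounds_away
  have ha : 0 < ‖a m‖ := norm_pos_iff.2 ham
  have hint := (memLp_two_iff_integrable_sq_norm hmem.1).1 hmem
  have hr : Tendsto (fun n : ℕ => ((n : ℝ) + 1 / 2) * Real.pi) atTop atTop :=
    (tendsto_atTop_add_const_right _ _ tendsto_natCast_atTop_atTop).atTop_mul_const Real.pi_pos
  obtain ⟨n₀, hn₀⟩ := eventually_atTop.1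
    (hr.eventually_ge_atTop (max (max R₁ R₂) 1 + 1 / 2))
  -- One half is lost to `|sin x| ≥ 1/2` and one half to the lower bound for the polynomial; the
  -- powers of `x` leave `1 / x`.
  refine not_integrableOn_of_ge_div (β := (b * ‖a m‖ / 4) ^ 2) (by positivity) (n₀ := n₀)
    (fun n hn x hx => ?_) hint
  have hbig : max (max R₁ R₂) 1 ≤ x := by
    have := hn₀ n hn
    linarith [(abs_le.1 hx).1]
  have hx1 : 1 ≤ x := (le_max_right _ _).trans hbig
  have hxR₁ : R₁ ≤ x := (le_max_left _ _).trans ((le_max_left _ _).trans hbig)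
  have hxR₂ : R₂ ≤ x := (le_max_right _ _).trans ((le_max_left _ _).trans hbig)
  have hnx : ‖(x : ℂ)‖ = x := by rw [Complex.norm_real, Real.norm_of_nonneg (by linarith)]
  have hnx2 : ‖((x ^ 2 : ℝ) : ℂ)‖ = x ^ 2 := by
    rw [Complex.norm_real, Real.norm_of_nonneg (by positivity)]
  have h1 := hR₁ ((x ^ 2 : ℝ) : ℂ) (by rw [hnx2]; nlinarith)
  have h2 := (hR₂ (x : ℂ) (awayFromPi_ofReal hx) (by rw [hnx]; exact hxR₂)).1
  rw [hnx2] at h1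
  rw [hnx, ← Complex.ofReal_sin, Complex.norm_real, Real.norm_eq_abs, ← Complex.ofReal_pow] at h2
  have h3 := one_half_le_abs_sin hx
  have hx0 : 0 < x := by linarith
  have h4 : b / 2 / x ^ (2 * m + 1) ≤ ‖zeroProduct ν ((x ^ 2 : ℝ) : ℂ)‖ := by
    rw [div_le_iff₀ (by positivity)]
    nlinarith
  rw [norm_mul, ← div_pow]
  refine pow_le_pow_left₀ (by positivity) ?_ 2
  calc b * ‖a m‖ / 4 / x = b / 2 / x ^ (2 * m + 1) * (‖a m‖ / 2 * (x ^ 2) ^ m) := by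
        field_simp
        ring
    _ ≤ _ := by gcongr

/-- The product times a polynomial of degree less than `m` decays like `exp |Im √z| / |z|`. -/
lemma exists_mul_polynomial_bound (h : IsPerturbedDirichlet m ν) (a : ℕ → ℂ) :
    ∃ D R : ℝ, 0 < D ∧ 1 ≤ R ∧ ∀ w : ℂ, 0 ≤ w.re → R ≤ ‖w‖ →
      ‖w‖ ^ 2 * ‖zeroProduct ν (w ^ 2) * ∑ k ∈ Finset.range m, a k * (w ^ 2) ^ k‖
        ≤ D * Real.exp |w.im| := by
  obtain ⟨B, R, hB, hR⟩ := h.exists_upper_bound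
  set S := ∑ k ∈ Finset.range m, ‖a k‖ with hS
  have hS0 : 0 ≤ S := Finset.sum_nonneg fun _ _ => norm_nonneg _
  refine ⟨(S + 1) * B, max R 1, by positivity, le_max_right _ _, fun w hre hw => ?_⟩
  have hw1 : 1 ≤ ‖w‖ := (le_max_right _ _).trans hw
  have h1 := hR w hre ((le_max_left _ _).trans hw)
  have h2 := norm_mul_norm_sum_le a m (z := w ^ 2) (by rw [norm_pow]; exact one_le_pow₀ hw1)
  rw [norm_pow, ← pow_mul] at h2
  have h3 : ‖w‖ ^ (2 * m) * ‖zeroProduct ν (w ^ 2)‖ ≤ B * Real.exp |w.im| := by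
    refine le_trans ?_ h1
    gcongr
    omega
  rw [norm_mul]
  calc ‖w‖ ^ 2 * (‖zeroProduct ν (w ^ 2)‖ * ‖∑ k ∈ Finset.range m, a k * (w ^ 2) ^ k‖)
      = ‖zeroProduct ν (w ^ 2)‖ * (‖w‖ ^ 2 * ‖∑ k ∈ Finset.range m, a k * (w ^ 2) ^ k‖) := by ring
    _ ≤ ‖zeroProduct ν (w ^ 2)‖ * (S * ‖w‖ ^ (2 * m)) := by gcongr
    _ = S * (‖w‖ ^ (2 * m) * ‖zeroProduct ν (w ^ 2)‖) := by ring
    _ ≤ S * (B * Real.exp |w.im|) := by gcongr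
    _ ≤ (S + 1) * (B * Real.exp |w.im|) := by
        gcongr
        linarith
    _ = _ := by ring

lemma differentiable_mul_polynomial (h : IsPerturbedDirichlet m ν) (a : ℕ → ℂ) :
    Differentiable ℂ fun z => zeroProduct ν z * ∑ k ∈ Finset.range m, a k * z ^ k :=
  h.differentiable.mul (by fun_prop)

lemma isBigO_mul_polynomial (h : IsPerturbedDirichlet m ν) (a : ℕ → ℂ) :
    (fun z => zeroProduct ν z * ∑ k ∈ Finset.range m, a k * z ^ k)
      =O[Bornology.cobounded ℂ] fun z : ℂ => Real.exp |(z ^ (1 / 2 : ℂ)).im| := by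
  obtain ⟨D, R, hD, hR1, hR⟩ := h.exists_mul_polynomial_bound a
  refine Asymptotics.IsBigO.of_bound D ?_
  rw [← comap_norm_atTop, eventually_comap]
  filter_upwards [eventually_ge_atTop (R ^ 2)] with r hr z hz
  have hw2 := norm_cpow_half_sq z
  have hwR : R ≤ ‖z ^ (1 / 2 : ℂ)‖ := by
    rw [← pow_le_pow_iff_left₀ (by linarith) (norm_nonneg _) two_ne_zero, hw2, hz]
    exact hr
  have h1 := hR _ (cpow_half_re_nonneg z) hwR
  rw [cpow_half_sq] at h1
  rw [Real.norm_of_nonneg (Real.exp_pos _).le]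
  refine le_trans (le_mul_of_one_le_left (norm_nonneg _) ?_) h1
  exact one_le_pow₀ (hR1.trans hwR)

lemma memLp_mul_polynomial (h : IsPerturbedDirichlet m ν) (a : ℕ → ℂ) :
    MemLp (fun t : ℝ => zeroProduct ν t * ∑ k ∈ Finset.range m, a k * (t : ℂ) ^ k) 2
      (volume.restrict (Set.Ioi (0 : ℝ))) := by
  obtain ⟨D, R, hD, hR1, hR⟩ := h.exists_mul_polynomial_bound a
  have hcont : Continuous fun t : ℝ =>
      zeroProduct ν t * ∑ k ∈ Finset.range m, a k * (t : ℂ) ^ k :=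
    (h.differentiable_mul_polynomial a).continuous.comp Complex.continuous_ofReal
  rw [memLp_two_iff_integrable_sq_norm hcont.aestronglyMeasurable]
  refine IntegrableOn.mono_set (t := Set.Ici 0) ?_ Set.Ioi_subset_Ici_self
  -- On the positive half-line `√t` is real, so the exponential is `1` and the function is bounded
  -- by `D / t`.
  refine LocallyIntegrableOn.integrableOn_of_isBigO_atTop (g := fun t : ℝ => t ^ (-2 : ℝ))
    ((hcont.norm.pow 2).locallyIntegrable.locallyIntegrableOn _) ?_
    (integrableAtFilter_rpow_atTop_iff.2 (by norm_num))
  refine Asymptotics.IsBigO.of_bound (D ^ 2) ?_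
  filter_upwards [eventually_ge_atTop (R ^ 2), eventually_gt_atTop 0] with t ht ht0
  have hs : √t ^ 2 = t := Real.sq_sqrt ht0.le
  have hsR : R ≤ √t := Real.le_sqrt_of_sq_le ht
  have hns : ‖((√t : ℝ) : ℂ)‖ = √t := by
    rw [Complex.norm_real, Real.norm_of_nonneg (Real.sqrt_nonneg _)]
  have h1 := hR ((√t : ℝ) : ℂ) (by simp [Real.sqrt_nonneg]) (by rw [hns]; exact hsR)
  rw [hns, hs, ← Complex.ofReal_pow, hs, Complex.ofReal_im, abs_zero, Real.exp_zero, mul_one] at h1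
  rw [Real.norm_of_nonneg (by positivity), Real.norm_of_nonneg (by positivity), Real.rpow_neg ht0.le,
    Real.rpow_two, ← div_eq_mul_inv, ← div_pow]
  refine pow_le_pow_left₀ (norm_nonneg _) ?_ 2
  rw [le_div_iff₀ ht0, mul_comm]
  exact h1

end IsPerturbedDirichlet

/-! ### Enumeration of the unperturbed eigenvalues -/

/-- A set of points clustered near `π² n²`, with `n - m` of them below `π² n² + C` for large `n`,
can be enumerated so that the `k`-th point is near `π² (k + m + 1)²`. -/
lemma exists_equiv_isPerturbedDirichlet {lam : ℕ → ℝ} (hpos : ∀ α, 0 < lam α)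
    (hmono : StrictMono lam) {s : Set ℕ} {C : ℝ} {m : ℕ}
    (hnear : ∀ α, ∃ n : ℕ, |lam α - Real.pi ^ 2 * (n : ℝ) ^ 2| ≤ C)
    (hcount : ∀ᶠ n : ℕ in atTop,
      (lam '' s ∩ Set.Iic (Real.pi ^ 2 * (n : ℝ) ^ 2 + C)).encard + (m : ℕ∞) = (n : ℕ∞)) :
    ∃ e : ℕ ≃ s, IsPerturbedDirichlet m fun k => lam (e k) := by
  classical
  obtain ⟨n₀, hn₀⟩ := eventually_atTop.1 hcount
  have hinf : s.Infinite := by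
    intro hfin
    have hle : ∀ n ≥ n₀, n ≤ hfin.toFinset.card + m := by
      intro n hn
      have h1 := hn₀ n hn
      have h2 : (lam '' s ∩ Set.Iic (Real.pi ^ 2 * (n : ℝ) ^ 2 + C)).encard
          ≤ (hfin.toFinset.card : ℕ∞) := by
        rw [← hfin.encard_eq_coe_toFinset_card]
        exact (Set.encard_le_encard Set.inter_subset_left).trans (Set.encard_image_le _ _)
      have h3 : (n : ℕ∞) ≤ (hfin.toFinset.card : ℕ∞) + m := by
        rw [← h1]; gcongr
      exact_mod_cast h3
    have := hle (n₀ + hfin.toFinset.card + m + 1) (by omega)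
    omega
  have : Infinite s := hinf.to_subtype
  set e := Nat.Subtype.orderIsoOfNat s with he
  set ν : ℕ → ℝ := fun k => lam (e k) with hν
  have hνmono : StrictMono ν := fun a b hab => hmono (e.strictMono hab)
  have himage : ∀ X : ℝ, lam '' s ∩ Set.Iic X = ν '' {k | ν k ≤ X} := by
    intro X
    ext y
    constructor
    · rintro ⟨⟨α, hα, rfl⟩, hy⟩
      refine ⟨e.symm ⟨α, hα⟩, ?_, ?_⟩
      · simpa [hν] using hy
      · simp [hν]
    · rintro ⟨k, hk, rfl⟩
      exact ⟨⟨e k, (e k).2, rfl⟩, hk⟩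
  -- The points below the threshold form an initial segment of the increasing sequence, and `n - m`
  -- of them means exactly the indices `k < n - m`.
  have hiff : ∀ n ≥ n₀, ∀ k, ν k ≤ Real.pi ^ 2 * (n : ℝ) ^ 2 + C ↔ k + 1 + m ≤ n := by
    intro n hn k
    have h1 := hn₀ n hn
    rw [himage, hνmono.injective.encard_image] at h1
    constructor
    · intro hk
      have hsub : (Finset.range (k + 1) : Set ℕ)
          ⊆ {k | ν k ≤ Real.pi ^ 2 * (n : ℝ) ^ 2 + C} := by
        intro i hi
        have : i ≤ k := by simpa [Nat.lt_succ_iff] using hi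
        exact (hνmono.monotone this).trans hk
      have h2 := Set.encard_le_encard hsub
      rw [Set.encard_coe_eq_coe_finsetCard, Finset.card_range] at h2
      have h3 : ((k + 1 : ℕ) : ℕ∞) + m ≤ n := by
        rw [← h1]; gcongr
      exact_mod_cast h3
    · intro hk
      by_contra hgt
      have hsub : {k | ν k ≤ Real.pi ^ 2 * (n : ℝ) ^ 2 + C} ⊆ (Finset.range k : Set ℕ) := by
        intro i hi
        have hlt : ν i < ν k := lt_of_le_of_lt hi (not_le.1 hgt)
        simpa using hνmono.lt_iff_lt.1 hlt
      have h2 := Set.encard_le_encard hsub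
      rw [Set.encard_coe_eq_coe_finsetCard, Finset.card_range] at h2
      have h3 : (n : ℕ∞) ≤ (k : ℕ∞) + m := by
        rw [← h1]; gcongr
      have h4 : n ≤ k + m := by exact_mod_cast h3
      omega
  have hpi := Real.pi_gt_three
  have hpi2 : 1 ≤ Real.pi ^ 2 := by nlinarith
  -- For `k ≥ c` the gap between consecutive `π²l²` exceeds `2C`, which rules out `l ≥ k + m + 2`.
  obtain ⟨c, hc⟩ := exists_nat_ge C
  have hclose : ∀ k ≥ n₀ + c, |ν k - dirichletEigenvalue m k| ≤ C := by
    intro k hk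
    have hup := (hiff (k + m + 1) (by omega) k).2 (by omega)
    have hlow : Real.pi ^ 2 * ((k + m : ℕ) : ℝ) ^ 2 + C < ν k := by
      rw [← not_le, hiff (k + m) (by omega)]
      omega
    obtain ⟨l, hl⟩ := hnear (e k)
    have hl1 : k + m + 1 ≤ l := by
      by_contra hcon
      have : (l : ℝ) ≤ ((k + m : ℕ) : ℝ) := by exact_mod_cast (by omega : l ≤ k + m)
      have h2 : Real.pi ^ 2 * (l : ℝ) ^ 2 ≤ Real.pi ^ 2 * ((k + m : ℕ) : ℝ) ^ 2 := by gcongr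
      have h3 := (abs_le.1 hl).2
      change lam (e k) - _ ≤ _ at h3
      change _ < lam (e k) at hlow
      linarith
    have hl2 : l ≤ k + m + 1 := by
      by_contra hcon
      have : ((k + m + 1 : ℕ) : ℝ) + 1 ≤ l := by exact_mod_cast (by omega : k + m + 1 + 1 ≤ l)
      have h2 : Real.pi ^ 2 * (((k + m + 1 : ℕ) : ℝ) + 1) ^ 2 ≤ Real.pi ^ 2 * (l : ℝ) ^ 2 := by
        gcongr
      have h3 := (abs_le.1 hl).1
      have hCk : C ≤ ((k + m + 1 : ℕ) : ℝ) :=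
        hc.trans (by exact_mod_cast (by omega : c ≤ k + m + 1))
      change lam (e k) ≤ _ at hup
      nlinarith
    have hlk : l = k + m + 1 := le_antisymm hl2 hl1
    rw [hlk] at hl
    exact hl
  have hC0 : 0 ≤ C := (abs_nonneg _).trans (hclose _ le_rfl)
  -- The finitely many initial deviations are absorbed into the constant by adding them all.
  refine ⟨e.toEquiv, fun k => hpos _,
    C + ∑ i ∈ Finset.range (n₀ + c), |ν i - dirichletEigenvalue m i|, fun k => ?_⟩
  change |ν k - dirichletEigenvalue m k| ≤ _
  have hsum : 0 ≤ ∑ i ∈ Finset.range (n₀ + c), |ν i - dirichletEigenvalue m i| :=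
    Finset.sum_nonneg fun _ _ => abs_nonneg _
  rcases le_or_gt (n₀ + c) k with hk | hk
  · linarith [hclose k hk]
  · have := Finset.single_le_sum (f := fun i => |ν i - dirichletEigenvalue m i|)
      (fun _ _ => abs_nonneg _) (Finset.mem_range.2 hk)
    linarith

/-! ### The block Hankel matrix as a Gram matrix; coordinatewise reductions -/

section

variable {N : ℕ} {lam : ℕ → ℝ} {P : ℕ → Matrix (Fin N) (Fin N) ℂ} {A : Finset ℕ}

lemma canonicalProduct_eq_zeroProduct {j : Fin N} (e : ℕ ≃ unperturbedIndices P A j) (z : ℂ) :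
    canonicalProduct lam P A j z = zeroProduct (fun k => lam (e k)) z := by
  rw [canonicalProduct, zeroProduct, linearProduct, ← e.tprod_eq]
  exact tprod_congr fun k => by rw [div_eq_mul_inv]

lemma multipliable_canonicalProduct {m : ℕ} {j : Fin N} (e : ℕ ≃ unperturbedIndices P A j)
    (he : IsPerturbedDirichlet m fun k => lam (e k)) (z : ℂ) :
    Multipliable fun α : unperturbedIndices P A j => 1 - z / (lam α : ℂ) := by
  rw [← e.multipliable_iff]
  simpa [Function.comp_def, div_eq_mul_inv] using
    multipliable_one_sub_mul (summable_norm_inv_ofReal he.summable_inv) z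

lemma star_canonicalProduct_ofReal {j : Fin N}
    (hm : ∀ z : ℂ, Multipliable fun α : unperturbedIndices P A j => 1 - z / (lam α : ℂ)) (x : ℝ) :
    star (canonicalProduct lam P A j x) = canonicalProduct lam P A j x := by
  have := (hm x).map_tprod (starRingEnd ℂ) Complex.continuous_conj
  rw [canonicalProduct, ← starRingEnd_apply, this]
  exact tprod_congr fun α => by simp

lemma conjTranspose_diagF
    (hm : ∀ (j : Fin N) (z : ℂ),
      Multipliable fun α : unperturbedIndices P A j => 1 - z / (lam α : ℂ)) (x : ℝ) :
    (diagF lam P A x)ᴴ = diagF lam P A x := by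
  rw [diagF, Matrix.diagonal_conjTranspose]
  congr 1
  funext j
  exact star_canonicalProduct_ofReal (hm j) x

lemma isHermitian_hankelCoeff (hP : ∀ α, IsStarProjection (P α))
    (hF : ∀ x : ℝ, (diagF lam P A x)ᴴ = diagF lam P A x) (k : ℕ) :
    (hankelCoeff lam P A k).IsHermitian := by
  rw [Matrix.IsHermitian, hankelCoeff, Matrix.conjTranspose_sum]
  refine Finset.sum_congr rfl fun α _ => ?_
  have hPα : (P α)ᴴ = P α := (hP α).isSelfAdjoint
  rw [Matrix.conjTranspose_smul, Matrix.conjTranspose_mul, Matrix.conjTranspose_mul, hF, hPα,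
    Matrix.mul_assoc]
  congr 1
  simp

/-- The matrix of the map `(v_q) ↦ P_α F(lam α) ∑ (lam α)^q v_q`. -/
def evaluationMatrix (lam : ℕ → ℝ) (P : ℕ → Matrix (Fin N) (Fin N) ℂ) (A : Finset ℕ) (m α : ℕ) :
    Matrix (Fin N) (Fin m × Fin N) ℂ :=
  Matrix.of fun i q => (lam α : ℂ) ^ (q.1 : ℕ) * (P α * diagF lam P A (lam α : ℂ)) i q.2

/-- As `P α` is a self-adjoint idempotent and `F` is Hermitian at real points, `F P F = (P F)ᴴ (P
F)`; the Hankel weight `λ^(p+q)` splits as `λ^p λ^q`. -/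
lemma blockHankel_eq_sum (hP : ∀ α, IsStarProjection (P α))
    (hF : ∀ x : ℝ, (diagF lam P A x)ᴴ = diagF lam P A x) (m : ℕ) :
    blockHankel lam P A m
      = ∑ α ∈ A, (evaluationMatrix lam P A m α)ᴴ * evaluationMatrix lam P A m α := by
  ext p q
  rw [blockHankel, Matrix.of_apply, hankelCoeff, Matrix.sum_apply, Matrix.sum_apply]
  refine Finset.sum_congr rfl fun α _ => ?_
  have hPα : (P α)ᴴ = P α := (hP α).isSelfAdjoint
  have hPP : P α * P α = P α := (hP α).isIdempotentElem
  set G := P α * diagF lam P A (lam α : ℂ) with hG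
  have hGG : diagF lam P A (lam α : ℂ) * P α * diagF lam P A (lam α : ℂ) = Gᴴ * G := by
    rw [hG, Matrix.conjTranspose_mul, hF, hPα, Matrix.mul_assoc, Matrix.mul_assoc,
      ← Matrix.mul_assoc (P α), hPP]
  rw [hGG, Matrix.smul_apply, Matrix.mul_apply, Matrix.mul_apply, smul_eq_mul, Finset.mul_sum]
  refine Finset.sum_congr rfl fun i _ => ?_
  simp only [Matrix.conjTranspose_apply, evaluationMatrix, Matrix.of_apply, ← hG, star_mul']
  have : star ((lam α : ℂ) ^ (p.1 : ℕ)) = (lam α : ℂ) ^ (p.1 : ℕ) := by simp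
  rw [this, pow_add]
  ring

lemma evaluationMatrix_mulVec (m α : ℕ) (x : Fin m × Fin N → ℂ) :
    evaluationMatrix lam P A m α *ᵥ x = P α *ᵥ fun j =>
      canonicalProduct lam P A j (lam α) * ∑ q : Fin m, x (q, j) * (lam α : ℂ) ^ (q : ℕ) := by
  funext i
  simp only [Matrix.mulVec, dotProduct, evaluationMatrix, Matrix.of_apply, diagF,
    Matrix.mul_diagonal, Fintype.sum_prod_type]
  rw [Finset.sum_comm]
  refine Finset.sum_congr rfl fun j _ => ?_
  rw [Finset.mul_sum, Finset.mul_sum]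
  exact Finset.sum_congr rfl fun q _ => by ring

lemma posSemidef_sum_conjTranspose_mul_self {ι κ n : Type*} [Fintype κ] [Fintype n] (s : Finset ι)
    (B : ι → Matrix κ n ℂ) : (∑ α ∈ s, (B α)ᴴ * B α).PosSemidef :=
  Matrix.posSemidef_sum s fun α _ => Matrix.posSemidef_conjTranspose_mul_self (B α)

/-- The quadratic form is the sum of `‖B α x‖²`, which vanishes only if every term does. -/
lemma posDef_sum_conjTranspose_mul_self_iff {ι κ n : Type*} [Fintype κ] [Fintype n] (s : Finset ι)
    (B : ι → Matrix κ n ℂ) :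
    (∑ α ∈ s, (B α)ᴴ * B α).PosDef ↔ ∀ x : n → ℂ, (∀ α ∈ s, B α *ᵥ x = 0) → x = 0 := by
  have hq : ∀ x : n → ℂ, star x ⬝ᵥ ((∑ α ∈ s, (B α)ᴴ * B α) *ᵥ x)
      = ∑ α ∈ s, star (B α *ᵥ x) ⬝ᵥ (B α *ᵥ x) := by
    intro x
    rw [Matrix.sum_mulVec, dotProduct_sum]
    refine Finset.sum_congr rfl fun α _ => ?_
    rw [← Matrix.mulVec_mulVec, Matrix.dotProduct_mulVec, Matrix.vecMul_conjTranspose, star_star]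
  have hnn : ∀ x : n → ℂ, ∀ α ∈ s, 0 ≤ star (B α *ᵥ x) ⬝ᵥ (B α *ᵥ x) :=
    fun x α _ => dotProduct_star_self_nonneg _
  constructor
  · intro h x hx
    by_contra hne
    have h1 := h.dotProduct_mulVec_pos hne
    rw [hq, Finset.sum_eq_zero fun α hα => by rw [hx α hα]; simp] at h1
    exact lt_irrefl _ h1
  · intro h
    refine Matrix.PosDef.of_dotProduct_mulVec_pos (posSemidef_sum_conjTranspose_mul_self s B).1
      fun x hx => ?_
    rw [hq]
    refine (Finset.sum_nonneg (hnn x)).lt_of_ne fun h0 => hx (h x fun α hα => ?_)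
    exact dotProduct_star_self_eq_zero.1 ((Finset.sum_eq_zero_iff_of_nonneg (hnn x)).1 h0.symm α hα)

lemma mulVec_eq_zero_iff_of_isCoordinateProjector {α : ℕ} (hα : α ∉ A)
    (hcoord : IsCoordinateProjector (P α)) (v : Fin N → ℂ) :
    P α *ᵥ v = 0 ↔ ∀ j, α ∈ unperturbedIndices P A j → v j = 0 := by
  obtain ⟨S, hS⟩ := hcoord
  have hmem : ∀ j, α ∈ unperturbedIndices P A j ↔ j ∈ S := by
    intro j
    simp only [unperturbedIndices, Set.mem_ofPred_eq, hα, not_false_eq_true, true_and, hS]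
    rw [Ne, funext_iff, not_forall]
    constructor
    · rintro ⟨i, hi⟩
      rw [Matrix.mulVec_diagonal] at hi
      by_contra hj
      apply hi
      by_cases hij : i = j
      · simp [hij, hj]
      · simp [hij]
    · intro hj
      exact ⟨j, by simp [Matrix.mulVec_diagonal, hj]⟩
  simp only [hmem]
  rw [funext_iff]
  refine forall_congr' fun j => ?_
  rw [hS, Matrix.mulVec_diagonal]
  by_cases hj : j ∈ S <;> simp [hj]

lemma isAdmissible_iff (ξ : ℂ → EuclideanSpace ℂ (Fin N)) :
    IsAdmissible ξ ↔ ∀ j, Differentiable ℂ (fun z => ξ z j) ∧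
      ((fun z => ξ z j) =O[Bornology.cobounded ℂ]
        fun z : ℂ => Real.exp |(z ^ (1 / 2 : ℂ)).im|) ∧
      MemLp (fun t : ℝ => ξ (t : ℂ) j) 2 (volume.restrict (Set.Ioi (0 : ℝ))) := by
  constructor
  · intro h j
    refine ⟨differentiable_euclidean.1 h.entire j, ?_, h.memLp.eval_piLp j⟩
    refine Asymptotics.IsBigO.trans (Asymptotics.IsBigO.of_bound 1 ?_) h.growth
    exact Eventually.of_forall fun z => by simpa using PiLp.norm_apply_le (ξ z) j
  · intro h
    refine ⟨differentiable_euclidean.2 fun j => (h j).1, ?_, MemLp.of_eval_piLp fun j => (h j).2.2⟩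
    have h1 : (fun z => WithLp.ofLp (ξ z)) =O[Bornology.cobounded ℂ]
        fun z : ℂ => Real.exp |(z ^ (1 / 2 : ℂ)).im| :=
      Asymptotics.isBigO_pi.2 fun j => (h j).2.1
    exact ((PiLp.continuousLinearEquiv 2 ℂ fun _ : Fin N => ℂ).symm.isBigO_comp
      (fun z => WithLp.ofLp (ξ z)) (Bornology.cobounded ℂ)).trans h1

end

/-! ### Condition (C) and positive definiteness -/

lemma eq_zero_of_sum_eq_zero_of_neg {m : ℕ} {x : Fin m → ℂ}
    (h : ∀ t : ℝ, t < 0 → ∑ q : Fin m, x q * (t : ℂ) ^ (q : ℕ) = 0) : x = 0 := by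
  set p : Polynomial ℂ := ∑ q : Fin m, Polynomial.C (x q) * Polynomial.X ^ (q : ℕ) with hp
  have hroot : p = 0 := by
    refine Polynomial.eq_zero_of_infinite_isRoot p
      (((Set.Iio_infinite (0 : ℝ)).image Complex.ofReal_injective.injOn).mono ?_)
    rintro _ ⟨t, ht, rfl⟩
    have := h t ht
    simpa [hp, Polynomial.eval_finsetSum] using this
  funext q
  have := congrArg (fun r : Polynomial ℂ => r.coeff q) hroot
  simpa [hp, Polynomial.finsetSum_coeff, Polynomial.coeff_X_pow, Fin.val_inj] using this

section

variable {N m : ℕ} {lam : ℕ → ℝ} {P : ℕ → Matrix (Fin N) (Fin N) ℂ} {A : Finset ℕ}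
  {e : ∀ j, ℕ ≃ unperturbedIndices P A j}

lemma canonicalProduct_apply_eq_zero (he : ∀ j, IsPerturbedDirichlet m fun k => lam (e j k))
    {j : Fin N} {α : ℕ} (hα : α ∈ unperturbedIndices P A j) :
    canonicalProduct lam P A j (lam α) = 0 := by
  rw [canonicalProduct_eq_zeroProduct (e j)]
  simpa using (he j).zeroProduct_apply_eq_zero ((e j).symm ⟨α, hα⟩)

/-- The vector function `F p` with a polynomial `p` of degree less than `m` is admissible. -/
lemma isAdmissible_canonicalProduct_mul (he : ∀ j, IsPerturbedDirichlet m fun k => lam (e j k))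
    (x : Fin m × Fin N → ℂ) :
    IsAdmissible fun z => WithLp.toLp 2 fun j =>
      canonicalProduct lam P A j z * ∑ q : Fin m, x (q, j) * z ^ (q : ℕ) := by
  rw [isAdmissible_iff]
  intro j
  set a : ℕ → ℂ := fun k => if hk : k < m then x (⟨k, hk⟩, j) else 0 with ha
  have hsum : ∀ z : ℂ, ∑ q : Fin m, x (q, j) * z ^ (q : ℕ)
      = ∑ k ∈ Finset.range m, a k * z ^ k := by
    intro z
    rw [Finset.sum_range]
    exact Finset.sum_congr rfl fun q _ => by simp [ha]
  simp only [hsum, canonicalProduct_eq_zeroProduct (e j)]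
  exact ⟨(he j).differentiable_mul_polynomial a, (he j).isBigO_mul_polynomial a,
    (he j).memLp_mul_polynomial a⟩

/-- An admissible function whose components vanish at the unperturbed points is of the form
`F p` with a polynomial `p` of degree less than `m`. -/
lemma IsAdmissible.exists_eq_canonicalProduct_mul (hlam : Function.Injective lam)
    (he : ∀ j, IsPerturbedDirichlet m fun k => lam (e j k))
    {ξ : ℂ → EuclideanSpace ℂ (Fin N)} (hξ : IsAdmissible ξ)
    (hzero : ∀ j, ∀ α ∈ unperturbedIndices P A j, ξ (lam α) j = 0) :
    ∃ x : Fin m × Fin N → ℂ, ∀ z j,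
      ξ z j = canonicalProduct lam P A j z * ∑ q : Fin m, x (q, j) * z ^ (q : ℕ) := by
  rw [isAdmissible_iff] at hξ
  have key : ∀ j, ∃ a : ℕ → ℂ, ∀ z,
      ξ z j = canonicalProduct lam P A j z * ∑ k ∈ Finset.range m, a k * z ^ k := by
    intro j
    obtain ⟨hd, hg, hL⟩ := hξ j
    have hinj : Function.Injective fun k => lam (e j k) :=
      hlam.comp (Subtype.val_injective.comp (e j).injective)
    obtain ⟨a, ha⟩ := (he j).exists_polynomial_factor hinj hd hg
      fun k => hzero j _ (e j k).2
    simp only [ha] at hL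
    have ham := (he j).leadingCoeff_eq_zero_of_memLp hL
    refine ⟨a, fun z => ?_⟩
    rw [ha, canonicalProduct_eq_zeroProduct (e j), Finset.sum_range_succ, ham]
    simp
  choose a ha using key
  exact ⟨fun p => a p.2 p.1, fun z j => by rw [ha, Finset.sum_range]⟩

/-- Under `ξ = F p`, the conditions with `α ∉ A` hold automatically, and those with `α ∈ A` say that
the coefficient vector is killed by all evaluation matrices. -/
lemma conditionC_iff_posDef (hlam : Function.Injective lam) (hpos : ∀ α, 0 < lam α)
    (hP : ∀ α, IsStarProjection (P α)) (hcoord : ∀ α, α ∉ A → IsCoordinateProjector (P α))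
    (he : ∀ j, IsPerturbedDirichlet m fun k => lam (e j k))
    (hF : ∀ x : ℝ, (diagF lam P A x)ᴴ = diagF lam P A x) :
    ConditionC lam P ↔ (blockHankel lam P A m).PosDef := by
  rw [blockHankel_eq_sum hP hF, posDef_sum_conjTranspose_mul_self_iff]
  constructor
  · intro hC x hx
    have hz := hC _ (isAdmissible_canonicalProduct_mul he x) fun α => by
      by_cases hα : α ∈ A
      · exact (evaluationMatrix_mulVec m α x).symm.trans (hx α hα)
      · rw [mulVec_eq_zero_iff_of_isCoordinateProjector hα (hcoord α hα)]
        intro j hj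
        change canonicalProduct lam P A j (lam α) * _ = 0
        rw [canonicalProduct_apply_eq_zero he hj, zero_mul]
    funext p
    have hp : (fun q => x (q, p.2)) = 0 := by
      -- All zeros of `f_j` are positive, so at negative `t` it can be cancelled.
      refine eq_zero_of_sum_eq_zero_of_neg fun t ht => ?_
      have h1 : canonicalProduct lam P A p.2 t * ∑ q : Fin m, x (q, p.2) * (t : ℂ) ^ (q : ℕ) = 0 :=
        congrArg (fun v : EuclideanSpace ℂ (Fin N) => v p.2) (hz t)
      refine (mul_eq_zero.1 h1).resolve_left fun h0 => ?_
      rw [canonicalProduct_eq_zeroProduct (e p.2)] at h0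
      obtain ⟨k, hk⟩ := (he p.2).exists_eq_of_zeroProduct_eq_zero h0
      have hk' : t = lam (e p.2 k) := by exact_mod_cast hk
      linarith [hpos (e p.2 k)]
    exact congrFun hp p.1
  · intro h ξ hξ hPξ z
    have hzero : ∀ j, ∀ α ∈ unperturbedIndices P A j, ξ (lam α) j = 0 := fun j α hα =>
      (mulVec_eq_zero_iff_of_isCoordinateProjector hα.1 (hcoord α hα.1) _).1 (hPξ α) j hα
    obtain ⟨x, hx⟩ := hξ.exists_eq_canonicalProduct_mul hlam he hzero
    have hx0 : x = 0 := h x fun α _ => by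
      rw [evaluationMatrix_mulVec, ← hPξ α]
      congr 1
      funext j
      exact (hx _ j).symm
    ext j
    rw [hx z j, hx0]
    simp

end

end VectorSL

end

theorem propositionA5 (N m : ℕ) (lam : ℕ → ℝ) (P : ℕ → Matrix (Fin N) (Fin N) ℂ)
    (A : Finset ℕ)
    (hlam_pos : ∀ α, 0 < lam α) (hlam_mono : StrictMono lam)
    (hP : ∀ α, IsStarProjection (P α))
    (hcoord : ∀ α, α ∉ A → VectorSL.IsCoordinateProjector (P α))
    (hcount : ∃ C : ℝ, 0 < C ∧
      (∀ α, ∃ n : ℕ, |lam α - Real.pi ^ 2 * (n : ℝ) ^ 2| ≤ C) ∧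
      ∀ᶠ n : ℕ in Filter.atTop, ∀ j : Fin N,
        (lam '' VectorSL.unperturbedIndices P A j ∩
          Set.Iic (Real.pi ^ 2 * (n : ℝ) ^ 2 + C)).encard + (m : ℕ∞) = (n : ℕ∞))
    (hrank : ∑ α ∈ A, (P α).rank = N * m) :
    (∀ (j : Fin N) (z : ℂ),
      Multipliable fun α : VectorSL.unperturbedIndices P A j => 1 - z / (lam α : ℂ)) ∧
    (∀ k, (VectorSL.hankelCoeff lam P A k).IsHermitian) ∧
    (VectorSL.blockHankel lam P A m).PosSemidef ∧
    (VectorSL.ConditionC lam P ↔ (VectorSL.blockHankel lam P A m).PosDef) ∧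
    ((VectorSL.blockHankel lam P A m).PosDef ↔ (VectorSL.blockHankel lam P A m).det ≠ 0) := by
  obtain ⟨C, -, hnear, hcount⟩ := hcount
  have henum := fun j => VectorSL.exists_equiv_isPerturbedDirichlet hlam_pos hlam_mono hnear
    (hcount.mono fun n hn => hn j)
  choose e he using henum
  have hm := fun j z => VectorSL.multipliable_canonicalProduct (e j) (he j) z
  have hF := VectorSL.conjTranspose_diagF hm
  have hpsd : (VectorSL.blockHankel lam P A m).PosSemidef := by
    rw [VectorSL.blockHankel_eq_sum hP hF]
    exact VectorSL.posSemidef_sum_conjTranspose_mul_self _ _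
  exact ⟨hm, VectorSL.isHermitian_hankelCoeff hP hF, hpsd,
    VectorSL.conditionC_iff_posDef hlam_mono.injective hlam_pos hP hcoord he hF,
    hpsd.posDef_iff_det_ne_zero⟩
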